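/- **LAZO in the convex case.** Let $d\ge1$, $T\ge 1$, $R>0$, $L>0$, and put $\eta=\frac{R}{L\sqrt{dT}}$, $\delta=R\sqrt{d/T}$. Let $\mathcal X\subseteq\mathbb R^d$ be closed and convex with $\mathcal X\subseteq\{x:\|x\|\le R\}$, let $x_0\in\mathcal X$, and let $\mathcal X_\delta=\{x:\mathrm{dist}(x,\mathcal X)\le\delta\}$, which contains all points queried below. Let $f_0,\dots,f_T:\mathbb R^d\to\mathbb R$ be fixed loss functions, each convex and $L$-Lipschitz on $\mathcal X_\delta$. Let $u_0,u_1,\dots$ be independent and uniformly distributed on the unit sphere of $\mathbb R^d$, and put $w_t=x_t+\delta u_t$, where $$x_{t+1}=\Pi_{\mathcal X}\big(x_t-\eta\,\tilde g_t\big)$$ with $\Pi_{\mathcal X}$ the Euclidean projection onto $\mathcal X$. Here $\tilde g_0=\frac{d\,u_0}{2\delta}\big(f_0(x_0+\delta u_0)-f_0(x_0-\delta u_0)\big)$, and for $t\ge1$ $$\tilde g_t=\begin{cases}\frac{d\,u_t}{\delta}\big(f_t(w_t)-f_{t-1}(w_{t-1})\big),& u_t\in A_t,\\[2pt] \frac{d\,u_t}{2\delta}\big(f_t(x_t+\delta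 u_t)-f_t(x_t-\delta u_t)\big),&\text{otherwise.}\end{cases}$$ Given $u_0,\dots,u_{t-1}$, the region $A_t$ is the set of unit vectors $u_t$ with $D_t(w_t,w_{t-1})\le D$, where $D>0$ is a threshold and $$D_t(w,w')=\frac{|f_t(w)-f_{t-1}(w')|}{\|w-w'\|}\ \text{ for LAZOa},\qquad D_t(w,w')=\frac{|f_t(w)-f_{t-1}(w')|}{\eta L}\ \text{ for LAZOb}$$ (in the first quotient $a/0=\infty$ for $a>0$ and $0/0=0$); $A_0=\emptyset$. Let $A_t^s=\{u\in A_t:-u\in A_t\}$ be the largest symmetric subset of $A_t$. The expected static regret is $$\mathcal R_T=\mathbb E\Big[\sum_{t=0}^Tf_t(x_t)-\min_{x\in\mathcal X}\sum_{t=0}^Tf_t(x)\Big].$$ For all constants $K,M$ there is a constant $C$, depending only on $K$ and $M$, such that the following holds for all data as above. 1. (LAZOa) If $0<D\le M\frac{L}{\sqrt d}$, $D<\frac{L}{\sqrt{10}}$, and the regions of LAZOa satisfy $\sum_{t=0}^T\mathbb P(u_t\in A_t\setminus A_t^s)\le K\sqrt{T/d}$, then $\sum_{t=0}^T f_t(x_t)$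 is integrable and $\mathcal R_T\le C\,R\,L\sqrt{dT}$ for LAZOa. 2. (LAZOb) If $0<D\le M\sqrt d\,L$ and the regions of LAZOb satisfy $\sum_{t=0}^T\mathbb P(u_t\in A_t\setminus A_t^s)\le K\sqrt{T/d}$, then $\sum_{t=0}^T f_t(x_t)$ is integrable and $\mathcal R_T\le C\,R\,L\sqrt{dT}$ for LAZOb. -/

import Mathlib

open MeasureTheory ProbabilityTheory
open scoped ENNReal

namespace LAZO

/-- The Euclidean space of dimension `d`. -/
abbrev E (d : ℕ) : Type := EuclideanSpace ℝ (Fin d)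

/-- The Euclidean unit sphere of `E d`. -/
abbrev S (d : ℕ) : Type := Metric.sphere (0 : E d) 1

/-- The uniform distribution on the unit sphere: normalized surface measure. -/
noncomputable def sphereUniform (d : ℕ) : Measure (S d) :=
  ((volume : Measure (E d)).toSphere Set.univ)⁻¹ • (volume : Measure (E d)).toSphere

/-- Euclidean projection onto `X`: a point of `X` nearest to `y`. It exists and is unique when `X` is
nonempty, closed and convex; the other branch is a default value for other sets. -/
noncomputable def proj {d : ℕ} (X : Set (E d)) (y : E d) : E d :=
  open Classical in
  if h : ∃ p ∈ X, dist y p = Metric.infDist y X then h.choose else y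

/-- The largest symmetric subset of `A`: the union of all symmetric subsets of `A`. -/
def symmetricCore {d : ℕ} (A : Set (S d)) : Set (S d) :=
  ⋃₀ {B : Set (S d) | B ⊆ A ∧ ∀ v : S d, v ∈ B ↔ -v ∈ B}

/-- Temporal variation `|g x - g' y| / ‖x - y‖` between the current loss `g` at `x` and the previous
loss `g'` at `y`, as an extended nonnegative number. If `x = y` it is `∞` when the two values
differ, and `0` when they agree. -/
noncomputable def temporalVariationA {d : ℕ} (g g' : E d → ℝ) (x y : E d) : ℝ≥0∞ :=
  edist (g x) (g' y) / edist x y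

/-- Temporal variation `|g x - g' y| / (η L)`. -/
noncomputable def temporalVariationB {d : ℕ} (η L : ℝ) (g g' : E d → ℝ) (x y : E d) : ℝ :=
  |g x - g' y| / (η * L)

/-- A lazy rule: given the current and the previous loss and the current and the previous query point,
it decides whether the previous query is reused (one-point query). -/
abbrev Rule (d : ℕ) : Type := (E d → ℝ) → (E d → ℝ) → E d → E d → Prop

/-- The lazy rule of LAZOa with threshold `D`. -/
def ruleA {d : ℕ} (D : ℝ) : Rule d :=
  fun g g' w w' => temporalVariationA g g' w w' ≤ ENNReal.ofReal D

/-- The lazy rule of LAZOb with threshold `D`. -/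
def ruleB {d : ℕ} (η L D : ℝ) : Rule d :=
  fun g g' w w' => temporalVariationB η L g g' w w' ≤ D

/-- The one-point residual gradient estimator; `w'` is the previous query point. -/
noncomputable def onePoint {d : ℕ} (δ : ℝ) (g g' : E d → ℝ) (x : E d) (v : S d) (w' : E d) : E d :=
  ((d : ℝ) / δ * (g (x + δ • (v : E d)) - g' w')) • (v : E d)

/-- The symmetric two-point gradient estimator. -/
noncomputable def twoPoint {d : ℕ} (δ : ℝ) (g : E d → ℝ) (x : E d) (v : S d) : E d :=
  ((d : ℝ) / (2 * δ) * (g (x + δ • (v : E d)) - g (x - δ • (v : E d)))) • (v : E d)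

/-- The lazy gradient estimator. -/
noncomputable def lazyEstimator {d : ℕ} (rule : Rule d) (δ : ℝ) (g g' : E d → ℝ)
    (x : E d) (v : S d) (w' : E d) : E d :=
  open Classical in
  if rule g g' (x + δ • (v : E d)) w' then onePoint δ g g' x v w' else twoPoint δ g x v

/-- The iterates `x_t` of LAZO along a sequence `u` of perturbation directions: round `0` uses the
two-point estimator, round `t ≥ 1` uses the lazy estimator with previous query point
`w_{t-1} = x_{t-1} + δ u_{t-1}`. -/
noncomputable def iterate {d : ℕ} (rule : Rule d) (X : Set (E d)) (f : ℕ → E d → ℝ) (x₀ : E d)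
    (η δ : ℝ) (u : ℕ → S d) : ℕ → E d
  | 0 => x₀
  | 1 => proj X (x₀ - η • twoPoint δ (f 0) x₀ (u 0))
  | t + 2 =>
      let x := iterate rule X f x₀ η δ u (t + 1)
      let x' := iterate rule X f x₀ η δ u t
      proj X (x - η • lazyEstimator rule δ (f (t + 1)) (f t) x (u (t + 1))
        (x' + δ • (u t : E d)))

/-- The region `A_t` of directions of round `t` for which the previous query is reused; given the
previous directions it is a subset of the sphere. There is no reuse in round `0`. -/
def reuseRegion {d : ℕ} (rule : Rule d) (X : Set (E d)) (f : ℕ → E d → ℝ) (x₀ : E d)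
    (η δ : ℝ) (u : ℕ → S d) : ℕ → Set (S d)
  | 0 => ∅
  | t + 1 => {v : S d | rule (f (t + 1)) (f t)
      (iterate rule X f x₀ η δ u (t + 1) + δ • (v : E d))
      (iterate rule X f x₀ η δ u t + δ • (u t : E d))}

/-- `∑_{t=0}^T P(A_t \ A_t^s)`, where `A_t^s` is the largest symmetric subset of `A_t`. -/
noncomputable def asymmetry {d : ℕ} {Ω : Type*} [MeasurableSpace Ω] (P : Measure Ω)
    (rule : Rule d) (X : Set (E d)) (f : ℕ → E d → ℝ) (x₀ : E d) (η δ : ℝ)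
    (u : ℕ → Ω → S d) (T : ℕ) : ℝ :=
  ∑ t ∈ Finset.range (T + 1), P.real {ω | u t ω ∈
    reuseRegion rule X f x₀ η δ (fun s => u s ω) t \
      symmetricCore (reuseRegion rule X f x₀ η δ (fun s => u s ω) t)}

/-- Cumulative loss `∑_{t=0}^T f_t(x_t)` of LAZO, as a random variable. -/
noncomputable def cumulativeLoss {d : ℕ} {Ω : Type*}
    (rule : Rule d) (X : Set (E d)) (f : ℕ → E d → ℝ) (x₀ : E d) (η δ : ℝ)
    (u : ℕ → Ω → S d) (T : ℕ) (ω : Ω) : ℝ :=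
  ∑ t ∈ Finset.range (T + 1), f t (iterate rule X f x₀ η δ (fun s => u s ω) t)

/-- Expected static regret of LAZO over the rounds `0, …, T`. -/
noncomputable def expectedRegret {d : ℕ} {Ω : Type*} [MeasurableSpace Ω] (P : Measure Ω)
    (rule : Rule d) (X : Set (E d)) (f : ℕ → E d → ℝ) (x₀ : E d) (η δ : ℝ)
    (u : ℕ → Ω → S d) (T : ℕ) : ℝ :=
  ∫ ω, (cumulativeLoss rule X f x₀ η δ u T ω
    - sInf ((fun y => ∑ t ∈ Finset.range (T + 1), f t y) '' X)) ∂P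

end LAZO

/-!
Both rules are instances of projected online gradient descent with a random estimator `g_t`, for which
telescoping `‖x_t - y‖²` bounds `∑ ⟪g_t, x_t - y⟫` by `‖x_0 - y‖² / (2 η) + η / 2 ∑ ‖g_t‖²`. What has to
be controlled is the mean and the second moment of `g_t`; the given choice of `η` and `δ` makes
`d η L = δ` and balances all terms at order `R L √(d T)`.

*Mean.* The mean of the two-point estimator at `x` is the gradient of the average of the loss over a
ball of radius `δ`, hence a subgradient up to an error `2 L δ` (`flux_le`). This form of the divergence
theorem needs only continuity of the loss: in polar coordinates, the unit ball centered at `t h` is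
`{r v : r < ρ_t(v)}` with an explicit `ρ_t` whose derivative at `t = 0` is `⟪v, h⟫`. The one-point
estimator differs from the two-point one by an odd function of the direction. Its mean therefore
vanishes over the symmetric core of the reuse region, and the rest of the region costs its
probability, which is what the asymmetry sums up (`le_integral_inner_gradient`).

*Second moment.* The one-point estimator is bounded through the lazy rule, directly for the second rule
and by a contraction in terms of the previous round for the first. The two-point estimator is of size
`d L` in the worst case, but its second moment is `O(d L²)`, because an `L`-Lipschitz function on the
sphere deviates by only `O(L / √d)` (`integral_sphere_sub_neg_sq_le`). For convex functions this
concentration has an elementary proof. A pair `(X, c X + s Y)` of Gaussian vectors, where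
`c² + s² = 1`, is exchangeable, so only the positive part of the increment of `F` matters, and that is
at most the pairing of the increment of the argument with a subgradient at `X`. A quarter circle cut
into `d` such steps leads from `X` to `Y`, whence a dimension-free bound for the variance of `F X`. The
transfer to the sphere uses that `‖X‖ • v`, for `v` uniform on the sphere and independent of `X`, is
again Gaussian, and that `‖X‖` is concentrated at `√d`, by the same variance bound applied to the
norm.

The losses are convex and Lipschitz only near `X`. As the algorithm never leaves the `δ`-thickening of
`X`, they can be replaced by globally convex and Lipschitz extensions, obtained by infimal convolution
with a multiple of the norm.
-/

namespace LAZO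

/-! ### Euclidean projection -/

section Projection

variable {d : ℕ} {X : Set (E d)}

theorem proj_spec (hX : IsClosed X) (hne : X.Nonempty) (y : E d) :
    proj X y ∈ X ∧ dist y (proj X y) = Metric.infDist y X := by
  have h : ∃ p ∈ X, dist y p = Metric.infDist y X := by
    obtain ⟨p, hp, h⟩ := hX.exists_infDist_eq_dist hne y
    exact ⟨p, hp, h.symm⟩
  unfold proj
  rw [dif_pos h]
  exact h.choose_spec

theorem proj_mem (hX : IsClosed X) (hne : X.Nonempty) (y : E d) : proj X y ∈ X :=
  (proj_spec hX hne y).1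

/-- The variational inequality that characterizes the projection. -/
theorem inner_sub_proj_le_zero (hX : IsClosed X) (hc : Convex ℝ X) (y : E d) {p : E d}
    (hp : p ∈ X) : inner ℝ (y - proj X y) (p - proj X y) ≤ 0 := by
  have hne : X.Nonempty := ⟨p, hp⟩
  obtain ⟨hm, hd⟩ := proj_spec hX hne y
  refine (norm_eq_iInf_iff_real_inner_le_zero hc hm).1 ?_ p hp
  rw [← dist_eq_norm, hd, Metric.infDist_eq_iInf]
  simp [dist_eq_norm]

theorem norm_proj_sub_proj_le (hX : IsClosed X) (hc : Convex ℝ X) (hne : X.Nonempty) (y z : E d) :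
    ‖proj X y - proj X z‖ ≤ ‖y - z‖ := by
  have h1 := inner_sub_proj_le_zero hX hc y (proj_mem hX hne z)
  have h2 := inner_sub_proj_le_zero hX hc z (proj_mem hX hne y)
  have h3 : ‖proj X y - proj X z‖ ^ 2 ≤ inner ℝ (y - z) (proj X y - proj X z) := by
    have e : inner ℝ (y - z) (proj X y - proj X z) - ‖proj X y - proj X z‖ ^ 2
        = - inner ℝ (y - proj X y) (proj X z - proj X y)
          - inner ℝ (z - proj X z) (proj X y - proj X z) := by
      rw [← real_inner_self_eq_norm_sq]
      simp only [inner_sub_left, inner_sub_right]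
      ring
    linarith
  have h4 := real_inner_le_norm (y - z) (proj X y - proj X z)
  by_contra! hlt
  nlinarith [norm_nonneg (y - z)]

theorem proj_of_mem (hX : IsClosed X) {y : E d} (hy : y ∈ X) : proj X y = y := by
  have := (proj_spec hX ⟨y, hy⟩ y).2
  rw [Metric.infDist_zero_of_mem hy] at this
  exact (dist_eq_zero.1 this).symm

theorem norm_proj_sub_le (hX : IsClosed X) (hc : Convex ℝ X) (z : E d) {y : E d} (hy : y ∈ X) :
    ‖proj X z - y‖ ≤ ‖z - y‖ := by
  simpa [proj_of_mem hX hy] using norm_proj_sub_proj_le hX hc ⟨y, hy⟩ z y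

theorem continuous_proj (hX : IsClosed X) (hc : Convex ℝ X) (hne : X.Nonempty) :
    Continuous (proj X) :=
  (LipschitzWith.of_dist_le' (K := 1) fun y z => by
    simpa [dist_eq_norm] using norm_proj_sub_proj_le hX hc hne y z).continuous

end Projection

/-! ### Convex Lipschitz functions -/

theorem continuous_of_lipschitz {V : Type*} [SeminormedAddCommGroup V] {F : V → ℝ} {l : ℝ}
    (hlip : ∀ x y, |F x - F y| ≤ l * ‖x - y‖) : Continuous F :=
  (LipschitzWith.of_dist_le' (K := l) fun a b => by
    simpa [Real.dist_eq, dist_eq_norm] using hlip a b).continuous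

section Convex

variable {V : Type*} [NormedAddCommGroup V]

/-- The infimal convolution of `f` restricted to `A` with `L ‖·‖`. If `f` is `L`-Lipschitz and convex
on `A`, it is an extension of `f` to the whole space with both properties. -/
noncomputable def lipschitzExtension (A : Set V) (L : ℝ) (f : V → ℝ) (z : V) : ℝ :=
  ⨅ y : A, (f y + L * ‖z - y‖)

variable {A : Set V} {L : ℝ} {f : V → ℝ}

theorem le_lipschitzExtension_term (hf : ∀ x ∈ A, ∀ y ∈ A, |f x - f y| ≤ L * ‖x - y‖) (hL : 0 ≤ L)
    {a : V} (ha : a ∈ A) (z : V) (y : A) : f a - L * ‖z - a‖ ≤ f y + L * ‖z - y‖ := by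
  have h1 := (abs_le.1 (hf a ha y y.2)).2
  have h2 : ‖a - (y : V)‖ ≤ ‖z - a‖ + ‖z - y‖ := by
    have := norm_sub_le (z - y) (z - a)
    simp only [sub_sub_sub_cancel_left] at this
    linarith
  nlinarith

theorem lipschitzExtension_le (hf : ∀ x ∈ A, ∀ y ∈ A, |f x - f y| ≤ L * ‖x - y‖) (hL : 0 ≤ L)
    (z : V) {y : V} (hy : y ∈ A) : lipschitzExtension A L f z ≤ f y + L * ‖z - y‖ :=
  ciInf_le ⟨f y - L * ‖z - y‖, by
    rintro _ ⟨w, rfl⟩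
    exact le_lipschitzExtension_term hf hL hy z w⟩ (⟨y, hy⟩ : A)

theorem lipschitzExtension_eq (hf : ∀ x ∈ A, ∀ y ∈ A, |f x - f y| ≤ L * ‖x - y‖) (hL : 0 ≤ L)
    {x : V} (hx : x ∈ A) : lipschitzExtension A L f x = f x := by
  have : Nonempty A := ⟨⟨x, hx⟩⟩
  apply le_antisymm
  · simpa using lipschitzExtension_le hf hL x hx
  · refine le_ciInf fun y => ?_
    simpa using le_lipschitzExtension_term hf hL hx x y

theorem lipschitzExtension_sub_le (hf : ∀ x ∈ A, ∀ y ∈ A, |f x - f y| ≤ L * ‖x - y‖) (hL : 0 ≤ L)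
    (hA : A.Nonempty) (x y : V) :
    |lipschitzExtension A L f x - lipschitzExtension A L f y| ≤ L * ‖x - y‖ := by
  have : Nonempty A := hA.to_subtype
  have key : ∀ x y : V, lipschitzExtension A L f x - L * ‖x - y‖ ≤ lipschitzExtension A L f y := by
    intro x y
    refine le_ciInf fun w => ?_
    have h1 := lipschitzExtension_le hf hL x w.2
    have h2 : ‖x - (w : V)‖ ≤ ‖x - y‖ + ‖y - w‖ := norm_sub_le_norm_sub_add_norm_sub ..
    nlinarith
  rw [abs_le]
  constructor
  · have := key y x
    rw [norm_sub_rev] at this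
    linarith
  · have := key x y
    linarith

theorem convexOn_lipschitzExtension [NormedSpace ℝ V]
    (hf : ∀ x ∈ A, ∀ y ∈ A, |f x - f y| ≤ L * ‖x - y‖) (hL : 0 ≤ L)
    (hA : A.Nonempty) (hconv : ConvexOn ℝ A f) :
    ConvexOn ℝ Set.univ (lipschitzExtension A L f) := by
  have : Nonempty A := hA.to_subtype
  refine ⟨convex_univ, fun x _ y _ a b ha hb hab => le_of_forall_pos_le_add fun ε hε => ?_⟩
  obtain ⟨p, hp⟩ := exists_lt_of_ciInf_lt (lt_add_of_pos_right (lipschitzExtension A L f x) hε)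
  obtain ⟨q, hq⟩ := exists_lt_of_ciInf_lt (lt_add_of_pos_right (lipschitzExtension A L f y) hε)
  have h1 := lipschitzExtension_le hf hL (a • x + b • y) (hconv.1 p.2 q.2 ha hb hab)
  have h2 := hconv.2 p.2 q.2 ha hb hab
  have h3 : ‖a • x + b • y - (a • (p : V) + b • (q : V))‖ ≤ a * ‖x - p‖ + b * ‖y - q‖ := by
    have e : a • x + b • y - (a • (p : V) + b • (q : V)) = a • (x - p) + b • (y - q) := by
      module
    rw [e]
    refine (norm_add_le _ _).trans ?_
    rw [norm_smul, norm_smul, Real.norm_of_nonneg ha, Real.norm_of_nonneg hb]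
  simp only [smul_eq_mul] at h2 ⊢
  have h4 := mul_le_mul_of_nonneg_left hp.le ha
  have h5 := mul_le_mul_of_nonneg_left hq.le hb
  have h6 := mul_le_mul_of_nonneg_left h3 hL
  have h7 : a * ε + b * ε = ε := by rw [← add_mul, hab, one_mul]
  nlinarith

end Convex

/-- A convex Lipschitz function on a Hilbert space has a subgradient at every point, of norm at most
the Lipschitz constant. -/
theorem exists_subgradient {V : Type*} [NormedAddCommGroup V] [InnerProductSpace ℝ V]
    [CompleteSpace V] {F : V → ℝ} {l : ℝ} (hl : 0 ≤ l) (hF : ConvexOn ℝ Set.univ F)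
    (hlip : ∀ x y, |F x - F y| ≤ l * ‖x - y‖) (x : V) :
    ∃ s : V, ‖s‖ ≤ l ∧ ∀ y, F x + inner ℝ s (y - x) ≤ F y := by
  have hcont : Continuous F := continuous_of_lipschitz hlip
  obtain ⟨φ, hφ⟩ := geometric_hahn_banach_open_point (s := {p : V × ℝ | p.1 ∈ Set.univ ∧ F p.1 < p.2})
    (x := (x, F x)) hF.convex_strict_epigraph (by
      simp only [Set.mem_univ, true_and]
      exact isOpen_lt (hcont.comp continuous_fst) continuous_snd) (by simp)
  set b : ℝ := φ (0, 1)
  have hsplit : ∀ (y : V) (t : ℝ), φ (y, t) = φ (y, 0) + t * b := by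
    intro y t
    have : (y, t) = (y, (0 : ℝ)) + t • ((0 : V), (1 : ℝ)) := by simp
    rw [this, map_add, map_smul, smul_eq_mul]
  have hb : b < 0 := by
    have := hφ (x, F x + 1) (by simp)
    rw [hsplit x, hsplit x (F x)] at this
    linarith
  let ψ : V →L[ℝ] ℝ := (-b)⁻¹ • (φ.comp (ContinuousLinearMap.inl ℝ V ℝ))
  have hψ : ∀ y, F x + ψ (y - x) ≤ F y := by
    intro y
    have h1 : φ (y, 0) + F y * b ≤ φ (x, 0) + F x * b := by
      refine le_of_forall_pos_le_add fun ε hε => ?_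
      have := hφ (y, F y + ε / (-b)) (by
        have : 0 < ε / (-b) := div_pos hε (by linarith)
        simp [this])
      rw [hsplit y, hsplit x] at this
      have e : (F y + ε / (-b)) * b = F y * b - ε := by
        have := hb.ne
        field_simp
        ring
      linarith
    have h2 : φ (y, 0) - φ (x, 0) ≤ (-b) * (F y - F x) := by linarith
    have h3 : ψ (y - x) = (-b)⁻¹ * (φ (y, 0) - φ (x, 0)) := by
      have : φ ((y - x, 0) : V × ℝ) = φ (y, 0) - φ (x, 0) := by
        rw [← map_sub]; simp
      simp [ψ, this]
    have h4 : (-b)⁻¹ * (φ (y, 0) - φ (x, 0)) ≤ F y - F x := by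
      rw [inv_mul_le_iff₀ (by linarith)]
      exact h2
    linarith
  refine ⟨(InnerProductSpace.toDual ℝ V).symm ψ, ?_, fun y => by simpa using hψ y⟩
  set s := (InnerProductSpace.toDual ℝ V).symm ψ with hs
  have h5 : ψ s = ‖s‖ ^ 2 := by
    rw [← real_inner_self_eq_norm_sq, hs, InnerProductSpace.toDual_symm_apply]
  have h6 := hψ (x + s)
  have h7 := (abs_le.1 (hlip (x + s) x)).2
  simp only [add_sub_cancel_left] at h6 h7
  by_contra! hlt
  nlinarith

/-! ### The uniform distribution on the sphere -/

theorem nontrivial_euclidean {d : ℕ} (hd : 1 ≤ d) : Nontrivial (E d) := by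
  have : Nonempty (Fin d) := ⟨⟨0, hd⟩⟩
  infer_instance

theorem isProbabilityMeasure_sphereUniform {d : ℕ} (hd : 1 ≤ d) :
    IsProbabilityMeasure (sphereUniform d) := by
  have := nontrivial_euclidean hd
  constructor
  simp only [sphereUniform, Measure.smul_apply, smul_eq_mul]
  exact ENNReal.inv_mul_cancel
    (Measure.measure_univ_ne_zero.2 (Measure.toSphere_ne_zero (volume : Measure (E d))))
    (measure_ne_top _ _)

/-- The action of a linear isometry on the unit sphere. -/
noncomputable def sphereMap {d : ℕ} (A : E d ≃ₗᵢ[ℝ] E d) (v : S d) : S d :=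
  ⟨A v, by simp⟩

@[simp] theorem coe_sphereMap {d : ℕ} (A : E d ≃ₗᵢ[ℝ] E d) (v : S d) :
    (sphereMap A v : E d) = A v := rfl

theorem measurable_sphereMap {d : ℕ} (A : E d ≃ₗᵢ[ℝ] E d) : Measurable (sphereMap A) :=
  (A.continuous.measurable.comp measurable_subtype_coe).subtype_mk

open scoped Pointwise in
theorem measurePreserving_sphereMap {d : ℕ} (A : E d ≃ₗᵢ[ℝ] E d) :
    MeasurePreserving (sphereMap A) (sphereUniform d) (sphereUniform d) := by
  refine ⟨measurable_sphereMap A, ?_⟩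
  rw [sphereUniform, Measure.map_smul]
  congr 1
  ext s hs
  rw [Measure.map_apply (measurable_sphereMap A) hs, Measure.toSphere_apply' _ hs,
    Measure.toSphere_apply' _ (measurable_sphereMap A hs)]
  congr 1
  have hA : MeasurePreserving A.toHomeomorph.toMeasurableEquiv volume volume := A.measurePreserving
  rw [← hA.measure_preimage_equiv (Set.Ioo (0 : ℝ) 1 • (Subtype.val '' s))]
  congr 1
  change _ = A ⁻¹' _
  ext z
  simp only [Set.mem_smul, Set.mem_image, Set.mem_preimage]
  constructor
  · rintro ⟨r, hr, _, ⟨v, hv, rfl⟩, rfl⟩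
    exact ⟨r, hr, _, ⟨sphereMap A v, hv, rfl⟩, by simp⟩
  · rintro ⟨r, hr, _, ⟨v, hv, rfl⟩, hz⟩
    change r • (v : E d) = A z at hz
    refine ⟨r, hr, _, ⟨sphereMap A.symm v, ?_, rfl⟩, ?_⟩
    · convert hv
      ext1
      simp
    · apply A.injective
      rw [← hz]
      simp

theorem measurePreserving_neg_sphereUniform (d : ℕ) :
    MeasurePreserving (fun v : S d => -v) (sphereUniform d) (sphereUniform d) := by
  convert measurePreserving_sphereMap (LinearIsometryEquiv.neg ℝ (E := E d)) using 1
  ext v : 2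
  simp

theorem integral_polar {d : ℕ} (hd : 1 ≤ d) {g : E d → ℝ} (hg : Integrable g) :
    ∫ x, g x = ∫ v : S d, (∫ r in Set.Ioi (0 : ℝ), r ^ (d - 1) * g (r • (v : E d)))
      ∂(volume : Measure (E d)).toSphere := by
  have := nontrivial_euclidean hd
  have hmp := (volume : Measure (E d)).measurePreserving_homeomorphUnitSphereProd
  have hemb := (homeomorphUnitSphereProd (E d)).measurableEmbedding
  set q : S d × Set.Ioi (0 : ℝ) → ℝ := fun p => g ((p.2 : ℝ) • (p.1 : E d)) with hq
  have hcomp : q ∘ homeomorphUnitSphereProd (E d) = fun x : ({(0)}ᶜ : Set (E d)) => g x := by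
    funext x
    have := homeomorphUnitSphereProd_symm_apply_coe (E d) (homeomorphUnitSphereProd (E d) x)
    rw [Homeomorph.symm_apply_apply] at this
    simp only [q, Function.comp_apply]
    rw [← this]
  have hint : Integrable q
      ((volume : Measure (E d)).toSphere.prod (.volumeIoiPow (Module.finrank ℝ (E d) - 1))) := by
    rw [← hmp.integrable_comp_emb hemb, hcomp]
    exact (integrableOn_iff_comap_subtypeVal (measurableSet_singleton _).compl).1 hg.integrableOn
  calc
    ∫ x, g x = ∫ x : ({(0)}ᶜ : Set (E d)), g x ∂((volume : Measure (E d)).comap (↑)) := by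
      rw [integral_subtype_comap (measurableSet_singleton _).compl g, restrict_compl_singleton]
    _ = ∫ p, q p ∂(volume : Measure (E d)).toSphere.prod
          (.volumeIoiPow (Module.finrank ℝ (E d) - 1)) := by
      rw [← hmp.integral_comp hemb]
      exact integral_congr_ae (.of_forall fun x => (congrFun hcomp x).symm)
    _ = _ := by
      rw [integral_prod _ hint]
      refine integral_congr_ae (.of_forall fun v => ?_)
      simp only [Measure.volumeIoiPow, ENNReal.ofReal, q]
      rw [integral_withDensity_eq_integral_smul,
        integral_subtype_comap measurableSet_Ioi fun a : ℝ ↦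
          Real.toNNReal (a ^ (Module.finrank ℝ (E d) - 1)) • g (a • (v : E d)),
        setIntegral_congr_fun measurableSet_Ioi fun x hx ↦ ?_]
      · simp only [finrank_euclideanSpace, Fintype.card_fin]
        rw [NNReal.smul_def, Real.coe_toNNReal _ (pow_nonneg hx.out.le _), smul_eq_mul]
      · exact (measurable_subtype_coe.pow_const _).real_toNNReal

/-! ### The divergence inequality on the sphere -/

/-- The distance from the origin, in direction `v`, to the boundary of the unit ball centered
at `t • h`. -/
noncomputable def shiftedRadius {d : ℕ} (h : E d) (t : ℝ) (v : E d) : ℝ :=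
  t * inner ℝ v h + √(1 - t ^ 2 * (‖h‖ ^ 2 - inner ℝ v h ^ 2))

section ShiftedRadius

variable {d : ℕ} {h : E d} {t : ℝ} {v : E d}

theorem sq_inner_le (hv : ‖v‖ = 1) : inner ℝ v h ^ 2 ≤ ‖h‖ ^ 2 := by
  have := abs_real_inner_le_norm v h
  rw [hv, one_mul] at this
  rw [← sq_abs]
  gcongr

theorem mem_ball_smul_iff (hv : ‖v‖ = 1) (ht : 0 ≤ t) (hth : t * ‖h‖ ≤ 1) {r : ℝ} (hr : 0 < r) :
    r • v ∈ Metric.ball (t • h) 1 ↔ r < shiftedRadius h t v := by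
  have ha := sq_inner_le (h := h) hv
  set a := inner ℝ v h with hadef
  have h1 : t ^ 2 * ‖h‖ ^ 2 ≤ 1 := by
    rw [← mul_pow]
    exact pow_le_one₀ (by positivity) hth
  have hlow : |t * a| ≤ √(1 - t ^ 2 * (‖h‖ ^ 2 - a ^ 2)) := by
    apply Real.abs_le_sqrt
    nlinarith
  have hn : ‖r • v - t • h‖ ^ 2 = (r - t * a) ^ 2 + t ^ 2 * (‖h‖ ^ 2 - a ^ 2) := by
    rw [norm_sub_sq_real, norm_smul, norm_smul, hv, inner_smul_left, inner_smul_right, ← hadef]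
    simp only [Real.norm_eq_abs, mul_one, mul_pow, sq_abs]
    simp
    ring
  rw [mem_ball_iff_norm, ← sq_lt_one_iff₀ (norm_nonneg _), hn]
  unfold shiftedRadius
  rw [← hadef]
  constructor
  · intro hlt
    have := Real.lt_sqrt_of_sq_lt (x := r - t * a) (y := 1 - t ^ 2 * (‖h‖ ^ 2 - a ^ 2))
      (by linarith)
    linarith
  · intro hlt
    have h2 : |r - t * a| < √(1 - t ^ 2 * (‖h‖ ^ 2 - a ^ 2)) := by
      rw [abs_lt]
      constructor
      · linarith [(abs_le.1 hlow).1, (abs_le.1 hlow).2]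
      · linarith
    rw [Real.lt_sqrt (abs_nonneg _), sq_abs] at h2
    linarith

theorem shiftedRadius_nonneg (hv : ‖v‖ = 1) (ht : 0 ≤ t) (hth : t * ‖h‖ ≤ 1) :
    0 ≤ shiftedRadius h t v := by
  have ha := sq_inner_le (h := h) hv
  have h1 : t ^ 2 * ‖h‖ ^ 2 ≤ 1 := by
    rw [← mul_pow]
    exact pow_le_one₀ (by positivity) hth
  have hlow : |t * inner ℝ v h| ≤ √(1 - t ^ 2 * (‖h‖ ^ 2 - inner ℝ v h ^ 2)) := by
    apply Real.abs_le_sqrt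
    nlinarith
  unfold shiftedRadius
  linarith [(abs_le.1 hlow).1]

theorem abs_shiftedRadius_sub_one_le (hv : ‖v‖ = 1) (ht : 0 ≤ t) (hth : t * ‖h‖ ≤ 1) :
    |shiftedRadius h t v - 1| ≤ 2 * (t * ‖h‖) := by
  have ha := sq_inner_le (h := h) hv
  have hab := abs_real_inner_le_norm v h
  rw [hv, one_mul] at hab
  have hta : |t * inner ℝ v h| ≤ t * ‖h‖ := by
    rw [abs_mul, abs_of_nonneg ht]
    gcongr
  have h0 : 0 ≤ t * ‖h‖ := by positivity
  have hs1 : √(1 - t ^ 2 * (‖h‖ ^ 2 - inner ℝ v h ^ 2)) ≤ 1 := by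
    rw [Real.sqrt_le_one]
    nlinarith [sq_nonneg t]
  have hs2 : 1 - t * ‖h‖ ≤ √(1 - t ^ 2 * (‖h‖ ^ 2 - inner ℝ v h ^ 2)) := by
    apply Real.le_sqrt_of_sq_le
    nlinarith [sq_nonneg t, sq_nonneg (t * inner ℝ v h)]
  unfold shiftedRadius
  rw [abs_le] at hta ⊢
  constructor <;> linarith

theorem shiftedRadius_zero : shiftedRadius h 0 v = 1 := by simp [shiftedRadius]

theorem hasDerivAt_shiftedRadius : HasDerivAt (fun t => shiftedRadius h t v) (inner ℝ v h) 0 := by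
  unfold shiftedRadius
  have h1 : HasDerivAt (fun t : ℝ => 1 - t ^ 2 * (‖h‖ ^ 2 - inner ℝ v h ^ 2)) 0 0 := by
    have := ((hasDerivAt_pow 2 (0 : ℝ)).mul_const (‖h‖ ^ 2 - inner ℝ v h ^ 2)).const_sub 1
    simpa using this
  have h2 := h1.sqrt (by simp)
  have h3 := (hasDerivAt_id (0 : ℝ)).mul_const (inner ℝ v h)
  have h4 := h3.add h2
  rw [one_mul, zero_div, add_zero] at h4
  exact h4

theorem continuous_shiftedRadius : Continuous (fun v : E d => shiftedRadius h t v) := by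
  unfold shiftedRadius
  fun_prop

end ShiftedRadius

section Divergence

variable {d : ℕ} {G : E d → ℝ}

/-- Integral of `G` along the ray in direction `v` up to the boundary of the unit ball centered
at `t • h`, weighted by the Jacobian of polar coordinates. -/
noncomputable def rayIntegral (G : E d → ℝ) (h : E d) (t : ℝ) (v : E d) : ℝ :=
  ∫ s in (0 : ℝ)..shiftedRadius h t v, s ^ (d - 1) * G (s • v)

theorem integral_ball_eq_integral_rayIntegral (hd : 1 ≤ d) (hG : Continuous G) {h : E d} {t : ℝ} (ht : 0 ≤ t)
    (hth : t * ‖h‖ ≤ 1) :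
    ∫ x in Metric.ball (t • h) 1, G x
      = ∫ v : S d, rayIntegral G h t v ∂(volume : Measure (E d)).toSphere := by
  have hint : IntegrableOn G (Metric.ball (t • h) 1) :=
    (hG.continuousOn.integrableOn_compact (isCompact_closedBall (t • h) 1)).mono_set
      Metric.ball_subset_closedBall
  rw [← integral_indicator measurableSet_ball,
    integral_polar hd ((integrable_indicator_iff measurableSet_ball).2 hint)]
  refine integral_congr_ae (.of_forall fun v => ?_)
  have hv : ‖(v : E d)‖ = 1 := by simp
  simp only [rayIntegral]
  rw [intervalIntegral.integral_of_le (shiftedRadius_nonneg hv ht hth),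
    ← integral_indicator measurableSet_Ioi, ← integral_indicator measurableSet_Ioc]
  have hne : ∀ᵐ r : ℝ, r ≠ shiftedRadius h t v := by
    simp [ae_iff, measure_singleton]
  refine integral_congr_ae ?_
  filter_upwards [hne] with r hr
  by_cases h0 : 0 < r
  · by_cases h1 : r < shiftedRadius h t v
    · have := (mem_ball_smul_iff hv ht hth h0).2 h1
      rw [Set.indicator_of_mem (by exact h0), Set.indicator_of_mem this,
        Set.indicator_of_mem (Set.mem_Ioc.2 ⟨h0, h1.le⟩)]
    · have := mt (mem_ball_smul_iff hv ht hth h0).1 h1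
      rw [Set.indicator_of_mem (by exact h0), Set.indicator_of_notMem this,
        Set.indicator_of_notMem (fun hmem => h1 (lt_of_le_of_ne hmem.2 hr)), mul_zero]
  · rw [Set.indicator_of_notMem (by exact h0), Set.indicator_of_notMem (fun hmem => h0 hmem.1)]

theorem continuous_rayIntegrand (hG : Continuous G) :
    Continuous (Function.uncurry fun (v : S d) (s : ℝ) => s ^ (d - 1) * G (s • (v : E d))) := by
  unfold Function.uncurry
  fun_prop

theorem continuous_rayIntegral (hG : Continuous G) (h : E d) (t : ℝ) :
    Continuous (fun v : S d => rayIntegral G h t v) := by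
  unfold rayIntegral
  exact intervalIntegral.continuous_parametric_intervalIntegral_of_continuous
    (continuous_rayIntegrand hG) (continuous_shiftedRadius.comp continuous_subtype_val)

theorem hasDerivAt_rayIntegral (hG : Continuous G) (h : E d) (v : E d) :
    HasDerivAt (fun t => rayIntegral G h t v) (G v * inner ℝ v h) 0 := by
  have hc : Continuous fun s : ℝ => s ^ (d - 1) * G (s • v) := by fun_prop
  have h1 := (hc.integral_hasStrictDerivAt 0 (shiftedRadius h 0 v)).hasDerivAt
  have h2 := h1.comp (0 : ℝ) hasDerivAt_shiftedRadius
  simp only [shiftedRadius_zero, one_pow, one_mul, one_smul] at h2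
  exact h2

/-- The derivative of `t ↦ ∫_{B(th, 1)} G` at `0` is the flux `∫ G(v) ⟪v, h⟫` over the sphere. -/
theorem tendsto_integral_ball_sub (hd : 1 ≤ d) (hG : Continuous G) (h : E d) :
    Filter.Tendsto (fun t : ℝ => t⁻¹ * ((∫ x in Metric.ball (t • h) 1, G x)
        - ∫ x in Metric.ball (0 : E d) 1, G x)) (nhdsWithin 0 (Set.Ioi 0))
      (nhds (∫ v : S d, G v * inner ℝ (v : E d) h ∂(volume : Measure (E d)).toSphere)) := by
  obtain ⟨B, hB⟩ := (isCompact_closedBall (0 : E d) 3).exists_bound_of_continuousOn hG.continuousOn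
  have hB0 : 0 ≤ B := (norm_nonneg _).trans (hB 0 (by simp))
  have hev : ∀ᶠ t : ℝ in nhdsWithin 0 (Set.Ioi 0), 0 < t ∧ t * ‖h‖ ≤ 1 := by
    refine (eventually_mem_nhdsWithin).and ?_
    have : Filter.Tendsto (fun t : ℝ => t * ‖h‖) (nhdsWithin 0 (Set.Ioi 0)) (nhds 0) := by
      have : Continuous fun t : ℝ => t * ‖h‖ := by fun_prop
      simpa using (this.tendsto 0).mono_left nhdsWithin_le_nhds
    exact this.eventually (ge_mem_nhds one_pos)
  have hint : ∀ t, Integrable (fun v : S d => rayIntegral G h t v)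
      (volume : Measure (E d)).toSphere := fun t =>
    (continuous_rayIntegral hG h t).integrable_of_hasCompactSupport
      (HasCompactSupport.of_compactSpace _)
  have key : Filter.Tendsto (fun t : ℝ => ∫ v : S d,
      t⁻¹ * (rayIntegral G h t v - rayIntegral G h 0 v) ∂(volume : Measure (E d)).toSphere)
      (nhdsWithin 0 (Set.Ioi 0))
      (nhds (∫ v : S d, G v * inner ℝ (v : E d) h ∂(volume : Measure (E d)).toSphere)) := by
    refine tendsto_integral_filter_of_dominated_convergence
      (fun _ => 3 ^ (d - 1) * B * (2 * ‖h‖)) ?_ ?_ (integrable_const _) ?_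
    · exact .of_forall fun t => (((hint t).sub (hint 0)).const_mul _).aestronglyMeasurable
    · filter_upwards [hev] with t ⟨ht, hth⟩
      refine .of_forall fun v => ?_
      have hv : ‖(v : E d)‖ = 1 := by simp
      have hr := abs_shiftedRadius_sub_one_le hv ht.le hth
      have hc : Continuous fun s : ℝ => s ^ (d - 1) * G (s • (v : E d)) := by fun_prop
      have e : rayIntegral G h t v - rayIntegral G h 0 v
          = ∫ s in (1 : ℝ)..shiftedRadius h t v, s ^ (d - 1) * G (s • (v : E d)) := by
        unfold rayIntegral
        rw [shiftedRadius_zero, intervalIntegral.integral_interval_sub_left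
          (hc.intervalIntegrable _ _) (hc.intervalIntegrable _ _)]
      have hb : ‖∫ s in (1 : ℝ)..shiftedRadius h t v, s ^ (d - 1) * G (s • (v : E d))‖
          ≤ 3 ^ (d - 1) * B * |shiftedRadius h t v - 1| := by
        refine intervalIntegral.norm_integral_le_of_norm_le_const fun s hs => ?_
        have hs' : |s| ≤ 3 := by
          have h1 := Set.uIoc_subset_uIcc hs
          rw [Set.mem_uIcc] at h1
          rw [abs_le] at hr ⊢
          have h0 := shiftedRadius_nonneg hv ht.le hth
          constructor <;> rcases h1 with h1 | h1 <;> linarith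
        rw [norm_mul, norm_pow, Real.norm_eq_abs]
        gcongr
        exact hB _ (by simpa [norm_smul] using hs')
      rw [e, norm_mul, norm_inv, Real.norm_of_nonneg ht.le]
      calc t⁻¹ * ‖∫ s in (1 : ℝ)..shiftedRadius h t v, s ^ (d - 1) * G (s • (v : E d))‖
          ≤ t⁻¹ * (3 ^ (d - 1) * B * (2 * (t * ‖h‖))) := by
            gcongr
            exact hb.trans (by gcongr)
        _ = 3 ^ (d - 1) * B * (2 * ‖h‖) := by field_simp
    · refine .of_forall fun v => ?_
      have := (hasDerivAt_rayIntegral hG h (v : E d)).tendsto_slope_zero_right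
      simpa using this
  refine key.congr' ?_
  filter_upwards [hev] with t ⟨ht, hth⟩
  have h0 := integral_ball_eq_integral_rayIntegral hd hG (h := h) le_rfl (by simp)
  rw [zero_smul] at h0
  rw [integral_const_mul, integral_sub (hint t) (hint 0),
    integral_ball_eq_integral_rayIntegral hd hG ht.le hth, h0]

/-- For convex Lipschitz `G`, the vector `d ∫ G(v) v dσ(v)` is a subgradient at `0` up to an error of
twice the Lipschitz constant: it is the gradient at `0` of the average of `G` over translates of the
unit ball. -/
theorem flux_le (hd : 1 ≤ d) {l : ℝ} (hl : 0 ≤ l) (hconv : ConvexOn ℝ Set.univ G)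
    (hlip : ∀ x y, |G x - G y| ≤ l * ‖x - y‖) (h : E d) :
    d * ∫ v : S d, G v * inner ℝ (v : E d) h ∂(sphereUniform d) ≤ G h - G 0 + 2 * l := by
  have := nontrivial_euclidean hd
  have hG : Continuous G := continuous_of_lipschitz hlip
  set V : ℝ := (volume : Measure (E d)).real (Metric.ball 0 1) with hV
  have hVpos : 0 < V := ENNReal.toReal_pos (Metric.measure_ball_pos _ _ one_pos).ne'
    measure_ball_lt_top.ne
  have hloc : ∀ c : E d, IntegrableOn (fun x => G (c + x)) (Metric.ball 0 1) := fun c =>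
    ((by fun_prop : Continuous fun x => G (c + x)).continuousOn.integrableOn_compact
      (isCompact_closedBall (0 : E d) 1)).mono_set Metric.ball_subset_closedBall
  have hshift : ∀ c : E d, ∫ x in Metric.ball c 1, G x = ∫ x in Metric.ball 0 1, G (c + x) := by
    intro c
    rw [← (measurePreserving_add_left volume c).setIntegral_preimage_emb
      (measurableEmbedding_addLeft c)]
    simp
  have hbound : ∀ᶠ t : ℝ in nhdsWithin 0 (Set.Ioi 0),
      t⁻¹ * ((∫ x in Metric.ball (t • h) 1, G x) - ∫ x in Metric.ball (0 : E d) 1, G x)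
        ≤ (G h - G 0 + 2 * l) * V := by
    have hlt : ∀ᶠ t : ℝ in nhdsWithin 0 (Set.Ioi 0), t < 1 :=
      nhdsWithin_le_nhds (gt_mem_nhds one_pos)
    filter_upwards [eventually_mem_nhdsWithin, hlt] with t ht ht1
    rw [Set.mem_Ioi] at ht
    have h0 := hloc 0
    simp only [zero_add] at h0
    rw [hshift, ← integral_sub (hloc _) h0, inv_mul_le_iff₀ ht]
    have hle : ∫ x in Metric.ball (0 : E d) 1, (G (t • h + x) - G x)
        ≤ ∫ x in Metric.ball (0 : E d) 1, t * (G h - G 0 + 2 * l) := by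
      refine setIntegral_mono_on ((hloc _).sub h0)
        (integrableOn_const measure_ball_lt_top.ne) measurableSet_ball
        fun x hx => ?_
      have hx1 : ‖x‖ ≤ 1 := (mem_ball_zero_iff.1 hx).le
      -- Convexity along `x, x + h` bounds the increment for `t` by `t` times that for `1`.
      have hc := hconv.2 (Set.mem_univ x) (Set.mem_univ (h + x)) 
        (show (0 : ℝ) ≤ 1 - t by linarith) ht.le (by ring)
      have e : (1 - t) • x + t • (h + x) = t • h + x := by module
      rw [e] at hc
      simp only [smul_eq_mul] at hc
      have h1 := (abs_le.1 (hlip (h + x) h)).2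
      have h2 := (abs_le.1 (hlip 0 x)).2
      simp only [add_sub_cancel_left, zero_sub, norm_neg] at h1 h2
      have h3 : l * ‖x‖ ≤ l := by nlinarith
      nlinarith
    refine hle.trans (le_of_eq ?_)
    rw [setIntegral_const, smul_eq_mul]
    ring
  have hlim := le_of_tendsto (tendsto_integral_ball_sub hd hG h) hbound
  have hS : (volume : Measure (E d)).toSphere.real Set.univ = d * V := by
    simp [hV]
  have hd' : (0 : ℝ) < d := by exact_mod_cast hd
  rw [sphereUniform, integral_smul_measure, ENNReal.toReal_inv, ← measureReal_def, hS, smul_eq_mul]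
  calc _ = V⁻¹ * ∫ v : S d, G v * inner ℝ (v : E d) h ∂(volume : Measure (E d)).toSphere := by
        field_simp
    _ ≤ V⁻¹ * ((G h - G 0 + 2 * l) * V) := by gcongr
    _ = _ := by field_simp

end Divergence

/-! ### Gaussian measures: rotations and moments -/

theorem integral_comp_of_measurePreserving {α β G : Type*} [MeasurableSpace α] [MeasurableSpace β]
    [NormedAddCommGroup G] [NormedSpace ℝ G] {μ : Measure α} {ν : Measure β} {φ : α → β}
    (h : MeasurePreserving φ μ ν) {f : β → G} (hf : AEStronglyMeasurable f ν) :
    ∫ x, f (φ x) ∂μ = ∫ y, f y ∂ν := by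
  rw [← h.map_eq] at hf ⊢
  exact (integral_map h.measurable.aemeasurable hf).symm


section Gaussian

variable {V : Type*} [NormedAddCommGroup V] [InnerProductSpace ℝ V] [FiniteDimensional ℝ V]
  [MeasurableSpace V] [BorelSpace V]

/-- The linear map `(x, y) ↦ (a x + b y, c x + e y)`. -/
def mixing (V : Type*) [NormedAddCommGroup V] [InnerProductSpace ℝ V] (a b c e : ℝ) :
    V × V →L[ℝ] V × V :=
  (a • ContinuousLinearMap.fst ℝ V V + b • ContinuousLinearMap.snd ℝ V V).prod
    (c • ContinuousLinearMap.fst ℝ V V + e • ContinuousLinearMap.snd ℝ V V)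

@[simp] theorem mixing_apply {V : Type*} [NormedAddCommGroup V] [InnerProductSpace ℝ V]
    (a b c e : ℝ) (p : V × V) :
    mixing V a b c e p = (a • p.1 + b • p.2, c • p.1 + e • p.2) := rfl

/-- A pair of independent standard Gaussian vectors is invariant in law under orthogonal mixing. -/
theorem measurePreserving_mixing {a b c e : ℝ} (hab : a ^ 2 + b ^ 2 = 1) (hce : c ^ 2 + e ^ 2 = 1)
    (horth : a * c + b * e = 0) :
    MeasurePreserving (mixing V a b c e) ((stdGaussian V).prod (stdGaussian V))
      ((stdGaussian V).prod (stdGaussian V)) := by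
  refine ⟨(mixing V a b c e).continuous.measurable, ?_⟩
  have : IsFiniteMeasure (((stdGaussian V).prod (stdGaussian V)).map (mixing V a b c e)) :=
    Measure.isFiniteMeasure_map _ _
  refine Measure.ext_of_charFunDual ?_
  funext L
  rw [charFunDual_map, charFunDual_prod, charFunDual_prod]
  set L₁ := L ∘SL ContinuousLinearMap.inl ℝ V V with hL₁
  set L₂ := L ∘SL ContinuousLinearMap.inr ℝ V V with hL₂
  have hL : ∀ x y, L (x, y) = L₁ x + L₂ y := by
    intro x y
    rw [hL₁, hL₂, ContinuousLinearMap.comp_apply, ContinuousLinearMap.comp_apply, ← map_add]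
    simp
  have e1 : (L ∘SL mixing V a b c e) ∘SL ContinuousLinearMap.inl ℝ V V = a • L₁ + c • L₂ := by
    ext x
    simp [hL]
  have e2 : (L ∘SL mixing V a b c e) ∘SL ContinuousLinearMap.inr ℝ V V = b • L₁ + e • L₂ := by
    ext x
    simp [hL]
  rw [e1, e2]
  simp only [charFunDual_stdGaussian, ← Complex.exp_add]
  congr 1
  obtain ⟨l₁, h₁⟩ := (InnerProductSpace.toDual ℝ V).surjective L₁
  obtain ⟨l₂, h₂⟩ := (InnerProductSpace.toDual ℝ V).surjective L₂
  have n1 : a • L₁ + c • L₂ = InnerProductSpace.toDual ℝ V (a • l₁ + c • l₂) := by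
    simp [h₁, h₂]
  have n2 : b • L₁ + e • L₂ = InnerProductSpace.toDual ℝ V (b • l₁ + e • l₂) := by
    simp [h₁, h₂]
  rw [n1, n2, ← h₁, ← h₂]
  simp only [LinearIsometryEquiv.norm_map]
  have key : ‖a • l₁ + c • l₂‖ ^ 2 + ‖b • l₁ + e • l₂‖ ^ 2 = ‖l₁‖ ^ 2 + ‖l₂‖ ^ 2 := by
    rw [norm_add_sq_real, norm_add_sq_real]
    simp only [norm_smul, inner_smul_left, inner_smul_right, mul_pow, Real.norm_eq_abs, sq_abs,
      conj_trivial]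
    linear_combination ‖l₁‖ ^ 2 * hab + ‖l₂‖ ^ 2 * hce + 2 * inner ℝ l₁ l₂ * horth
  have key' : (‖a • l₁ + c • l₂‖ : ℂ) ^ 2 + (‖b • l₁ + e • l₂‖ : ℂ) ^ 2
      = (‖l₁‖ : ℂ) ^ 2 + (‖l₂‖ : ℂ) ^ 2 := by exact_mod_cast key
  linear_combination (-1 / 2) * key'

theorem measurePreserving_combination {a b : ℝ} (hab : a ^ 2 + b ^ 2 = 1) :
    MeasurePreserving (fun p : V × V => a • p.1 + b • p.2)
      ((stdGaussian V).prod (stdGaussian V)) (stdGaussian V) :=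
  measurePreserving_fst.comp (measurePreserving_mixing (c := -b) (e := a) hab
    (by linarith) (by ring))

theorem integral_inner_stdGaussian (s : V) : ∫ x, inner ℝ s x ∂(stdGaussian V) = 0 := by
  simpa using integral_strongDual_stdGaussian (InnerProductSpace.toDual ℝ V s)

theorem memLp_inner_stdGaussian (s : V) : MemLp (fun x => inner ℝ s x) 2 (stdGaussian V) := by
  exact IsGaussian.memLp_dual (stdGaussian V) (InnerProductSpace.toDual ℝ V s) 2 (by simp)

theorem integral_inner_sq_stdGaussian (s : V) :
    ∫ x, inner ℝ s x ^ 2 ∂(stdGaussian V) = ‖s‖ ^ 2 := by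
  have h := variance_dual_stdGaussian (InnerProductSpace.toDual ℝ V s)
  rw [variance_eq_sub (IsGaussian.memLp_dual _ _ 2 (by simp)), LinearIsometryEquiv.norm_map] at h
  have h0 := integral_inner_stdGaussian s
  simp only [InnerProductSpace.toDual_apply_apply, Pi.pow_apply] at h
  rw [h0] at h
  simpa using h

theorem memLp_norm_stdGaussian : MemLp (fun x : V => ‖x‖) 2 (stdGaussian V) :=
  (IsGaussian.memLp_id (stdGaussian V) 2 (by simp)).norm

theorem integral_norm_sq_stdGaussian :
    ∫ x, ‖x‖ ^ 2 ∂(stdGaussian V) = Module.finrank ℝ V := by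
  let b := stdOrthonormalBasis ℝ V
  have : ∀ x : V, ‖x‖ ^ 2 = ∑ i, inner ℝ (b i) x ^ 2 := by
    intro x
    rw [← b.sum_sq_norm_inner_right x]
    simp
  simp_rw [this]
  rw [integral_finsetSum _ fun i _ => (memLp_inner_stdGaussian (b i)).integrable_sq]
  simp [integral_inner_sq_stdGaussian]

/-! ### A variance bound for convex Lipschitz functions of a Gaussian vector -/

section Variance

variable {F : V → ℝ} {l : ℝ}


theorem memLp_of_lipschitz (hlip : ∀ x y, |F x - F y| ≤ l * ‖x - y‖) :
    MemLp F 2 (stdGaussian V) := by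
  have h₁ : MemLp (fun _ : V => |F 0|) 2 (stdGaussian V) := memLp_const _
  have h₂ : MemLp (fun x : V => l * ‖x‖) 2 (stdGaussian V) := memLp_norm_stdGaussian.const_mul l
  refine (h₁.add h₂).mono (continuous_of_lipschitz hlip).aestronglyMeasurable (.of_forall fun x => ?_)
  have h1 := hlip x 0
  rw [sub_zero] at h1
  have h2 : |F x| ≤ |F 0| + l * ‖x‖ := by
    have := abs_sub_abs_le_abs_sub (F x) (F 0)
    linarith
  exact h2.trans (le_abs_self _)

theorem memLp_combination (hlip : ∀ x y, |F x - F y| ≤ l * ‖x - y‖) {a b : ℝ}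
    (hab : a ^ 2 + b ^ 2 = 1) :
    MemLp (fun p : V × V => F (a • p.1 + b • p.2)) 2 ((stdGaussian V).prod (stdGaussian V)) :=
  (memLp_of_lipschitz hlip).comp_measurePreserving (measurePreserving_combination hab)

theorem sq_eq_posPart_add (t : ℝ) : t ^ 2 = max t 0 ^ 2 + max (-t) 0 ^ 2 := by
  rcases le_total 0 t with h | h
  · rw [max_eq_left h, max_eq_right (by linarith)]
    ring
  · rw [max_eq_right h, max_eq_left (by linarith)]
    ring

/-- One rotation step. As `(X, c X + s Y)` is an exchangeable pair, the second moment of the increment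
of `F` is twice that of its positive part, and the latter is controlled by a subgradient at `X`, which
is independent of `Y`. -/
theorem integral_step_le (hl : 0 ≤ l) (hF : ConvexOn ℝ Set.univ F)
    (hlip : ∀ x y, |F x - F y| ≤ l * ‖x - y‖) {c s : ℝ} (hcs : c ^ 2 + s ^ 2 = 1) :
    ∫ p : V × V, (F p.1 - F (c • p.1 + s • p.2)) ^ 2 ∂((stdGaussian V).prod (stdGaussian V))
      ≤ 2 * l ^ 2 * ((1 - c) ^ 2 * Module.finrank ℝ V + s ^ 2) := by
  have hcont := continuous_of_lipschitz hlip
  have hm1 : MemLp (fun p : V × V => F p.1) 2 ((stdGaussian V).prod (stdGaussian V)) :=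
    (memLp_of_lipschitz hlip).comp_measurePreserving measurePreserving_fst
  have hm2 := memLp_combination hlip hcs
  set inc : V × V → ℝ := fun p => F p.1 - F (c • p.1 + s • p.2) with hinc
  have hm : MemLp inc 2 ((stdGaussian V).prod (stdGaussian V)) := hm1.sub hm2
  have hinc_cont : Continuous inc := by fun_prop
  have hpos : Integrable (fun p => max (inc p) 0 ^ 2) ((stdGaussian V).prod (stdGaussian V)) := by
    refine hm.integrable_sq.mono' (by fun_prop) (.of_forall fun p => ?_)
    rw [Real.norm_of_nonneg (sq_nonneg _), sq_eq_posPart_add (inc p)]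
    linarith [sq_nonneg (max (-inc p) 0)]
  have hneg : Integrable (fun p => max (-inc p) 0 ^ 2) ((stdGaussian V).prod (stdGaussian V)) := by
    refine hm.integrable_sq.mono' (by fun_prop) (.of_forall fun p => ?_)
    rw [Real.norm_of_nonneg (sq_nonneg _), sq_eq_posPart_add (inc p)]
    linarith [sq_nonneg (max (inc p) 0)]
  have hswap : ∫ p, max (-inc p) 0 ^ 2 ∂((stdGaussian V).prod (stdGaussian V))
      = ∫ p, max (inc p) 0 ^ 2 ∂((stdGaussian V).prod (stdGaussian V)) := by
    -- The reflection `(x, y) ↦ (c x + s y, s x - c y)` exchanges `x` and `c x + s y`.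
    have hR := measurePreserving_mixing (V := V) (a := c) (b := s) (c := s) (e := -c) hcs
      (by linarith) (by ring)
    rw [← integral_comp_of_measurePreserving hR (f := fun p => max (inc p) 0 ^ 2) (by fun_prop)]
    refine integral_congr_ae (.of_forall fun p => ?_)
    have hback : c • (c • p.1 + s • p.2) + s • (s • p.1 + -c • p.2) = p.1 := by
      have : c • (c • p.1 + s • p.2) + s • (s • p.1 + -c • p.2) = (c ^ 2 + s ^ 2) • p.1 := by
        module
      rw [this, hcs, one_smul]
    simp only [hinc, mixing_apply, hback, neg_sub]
  have hmain : ∫ p, max (inc p) 0 ^ 2 ∂((stdGaussian V).prod (stdGaussian V))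
      ≤ l ^ 2 * ((1 - c) ^ 2 * Module.finrank ℝ V + s ^ 2) := by
    rw [integral_prod _ hpos]
    have hinner : ∀ x : V, ∫ y, max (inc (x, y)) 0 ^ 2 ∂(stdGaussian V)
        ≤ l ^ 2 * ((1 - c) ^ 2 * ‖x‖ ^ 2 + s ^ 2) := by
      intro x
      obtain ⟨g, hg, hsub⟩ := exists_subgradient hl hF hlip x
      have hI1 := integral_inner_stdGaussian (V := V) g
      have hI2 := integral_inner_sq_stdGaussian (V := V) g
      have hJ1 := (memLp_inner_stdGaussian (V := V) g).integrable (by simp)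
      have hJ2 := (memLp_inner_stdGaussian (V := V) g).integrable_sq
      set α := (1 - c) * inner ℝ g x with hα
      have e : ∀ y : V, (α - s * inner ℝ g y) ^ 2
          = α ^ 2 - (2 * α * s) * inner ℝ g y + s ^ 2 * inner ℝ g y ^ 2 := fun y => by ring
      have hA : Integrable (fun y => α ^ 2 - (2 * α * s) * inner ℝ g y) (stdGaussian V) :=
        (integrable_const _).sub (hJ1.const_mul _)
      have hint : Integrable (fun y => (α - s * inner ℝ g y) ^ 2) (stdGaussian V) := by
        simp_rw [e]
        exact hA.add (hJ2.const_mul _)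
      calc ∫ y, max (inc (x, y)) 0 ^ 2 ∂(stdGaussian V)
          ≤ ∫ y, (α - s * inner ℝ g y) ^ 2 ∂(stdGaussian V) := by
            refine integral_mono_of_nonneg (.of_forall fun y => sq_nonneg _) hint
              (.of_forall fun y => ?_)
            have h1 := hsub (c • x + s • y)
            have h2 : inner ℝ g (c • x + s • y - x) = -(α - s * inner ℝ g y) := by
              rw [hα, inner_sub_right, inner_add_right, inner_smul_right, inner_smul_right]
              ring
            rw [h2] at h1
            have h3 : inc (x, y) ≤ α - s * inner ℝ g y := by
              simp only [hinc]
              linarith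
            simp only
            rcases le_total 0 (inc (x, y)) with h | h
            · rw [max_eq_left h]
              gcongr
            · rw [max_eq_right h]
              nlinarith [sq_nonneg (α - s * inner ℝ g y)]
        _ = α ^ 2 + s ^ 2 * ‖g‖ ^ 2 := by
            simp_rw [e]
            rw [integral_add hA (hJ2.const_mul _),
              integral_sub (integrable_const _) (hJ1.const_mul _), integral_const_mul,
              integral_const_mul, hI1, hI2]
            simp
        _ ≤ l ^ 2 * ((1 - c) ^ 2 * ‖x‖ ^ 2 + s ^ 2) := by
            have h1 : inner ℝ g x ^ 2 ≤ l ^ 2 * ‖x‖ ^ 2 := by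
              rw [← sq_abs, ← mul_pow]
              have := abs_real_inner_le_norm g x
              gcongr
              exact this.trans (by gcongr)
            have h2 : ‖g‖ ^ 2 ≤ l ^ 2 := by gcongr
            rw [hα, mul_pow]
            nlinarith [mul_le_mul_of_nonneg_left h1 (sq_nonneg (1 - c)),
              mul_le_mul_of_nonneg_left h2 (sq_nonneg s)]
    have hN := (memLp_norm_stdGaussian (V := V)).integrable_sq
    calc _ ≤ ∫ x : V, l ^ 2 * ((1 - c) ^ 2 * ‖x‖ ^ 2 + s ^ 2) ∂(stdGaussian V) := by
          refine integral_mono hpos.integral_prod_left ?_ hinner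
          exact ((hN.const_mul _).add (integrable_const _)).const_mul _
      _ = _ := by
          rw [integral_const_mul, integral_add (hN.const_mul _) (integrable_const _),
            integral_const_mul, integral_norm_sq_stdGaussian]
          simp
  have hsplit : ∫ p, inc p ^ 2 ∂((stdGaussian V).prod (stdGaussian V))
      = ∫ p, max (inc p) 0 ^ 2 ∂((stdGaussian V).prod (stdGaussian V))
        + ∫ p, max (-inc p) 0 ^ 2 ∂((stdGaussian V).prod (stdGaussian V)) := by
    rw [← integral_add hpos hneg]
    exact integral_congr_ae (.of_forall fun p => sq_eq_posPart_add (inc p))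
  rw [hsplit, hswap]
  linarith

/-- Two independent Gaussian vectors are joined by the quarter circle `cos θ X + sin θ Y`, cut into
`dim V` steps. -/
theorem integral_sub_sq_le (hl : 0 ≤ l) (hF : ConvexOn ℝ Set.univ F)
    (hlip : ∀ x y, |F x - F y| ≤ l * ‖x - y‖) (hd : 1 ≤ Module.finrank ℝ V) :
    ∫ p : V × V, (F p.1 - F p.2) ^ 2 ∂((stdGaussian V).prod (stdGaussian V)) ≤ 10 * l ^ 2 := by
  set n := Module.finrank ℝ V with hn
  have hn1 : (1 : ℝ) ≤ n := by exact_mod_cast hd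
  set θ : ℝ := Real.pi / 2 / n with hθ
  have hnθ : n * θ = Real.pi / 2 := by rw [hθ]; field_simp
  have hθ0 : 0 ≤ θ := by have := Real.pi_pos; positivity
  let c : ℕ → ℝ := fun k => Real.cos (k * θ)
  let s : ℕ → ℝ := fun k => Real.sin (k * θ)
  have hcs : ∀ k, c k ^ 2 + s k ^ 2 = 1 := fun k => Real.cos_sq_add_sin_sq _
  let a : ℕ → V × V → ℝ := fun k p =>
    F (c k • p.1 + s k • p.2) - F (c (k + 1) • p.1 + s (k + 1) • p.2)
  have ha : ∀ k, MemLp (a k) 2 ((stdGaussian V).prod (stdGaussian V)) := fun k =>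
    (memLp_combination hlip (hcs k)).sub (memLp_combination hlip (hcs (k + 1)))
  have htel : ∀ p, F p.1 - F p.2 = ∑ k ∈ Finset.range n, a k p := by
    intro p
    have := Finset.sum_range_sub' (fun k => F (c k • p.1 + s k • p.2)) n
    simp only [a]
    rw [this]
    simp [c, s, hnθ]
  -- By rotation invariance, every step has the law of the first one.
  have hstep : ∀ k, ∫ p, a k p ^ 2 ∂((stdGaussian V).prod (stdGaussian V))
      ≤ 2 * l ^ 2 * ((1 - Real.cos θ) ^ 2 * n + Real.sin θ ^ 2) := by
    intro k
    have hR := measurePreserving_mixing (V := V) (a := c k) (b := s k) (c := -s k) (e := c k)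
      (hcs k) (by linarith [hcs k]) (by ring)
    refine le_of_eq_of_le ?_ (integral_step_le hl hF hlip (Real.cos_sq_add_sin_sq θ))
    have hcont := continuous_of_lipschitz hlip
    rw [← integral_comp_of_measurePreserving hR
      (f := fun p : V × V => (F p.1 - F (Real.cos θ • p.1 + Real.sin θ • p.2)) ^ 2) (by fun_prop)]
    refine integral_congr_ae (.of_forall fun p => ?_)
    have h1 : Real.cos θ • (c k • p.1 + s k • p.2) + Real.sin θ • (-s k • p.1 + c k • p.2)
        = c (k + 1) • p.1 + s (k + 1) • p.2 := by
      have hc : c (k + 1) = c k * Real.cos θ - s k * Real.sin θ := by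
        simp only [c, s, Nat.cast_add, Nat.cast_one, add_mul, one_mul, Real.cos_add]
      have hs : s (k + 1) = s k * Real.cos θ + c k * Real.sin θ := by
        simp only [c, s, Nat.cast_add, Nat.cast_one, add_mul, one_mul, Real.sin_add]
      rw [hc, hs]
      module
    simp only [a, mixing_apply, h1]
  have hint : ∀ k ∈ Finset.range n, Integrable (fun p => a k p ^ 2)
      ((stdGaussian V).prod (stdGaussian V)) := fun k _ => (ha k).integrable_sq
  calc ∫ p : V × V, (F p.1 - F p.2) ^ 2 ∂((stdGaussian V).prod (stdGaussian V))
      ≤ ∫ p : V × V, n * ∑ k ∈ Finset.range n, a k p ^ 2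
          ∂((stdGaussian V).prod (stdGaussian V)) := by
        refine integral_mono_of_nonneg (.of_forall fun p => sq_nonneg _)
          ((integrable_finsetSum _ hint).const_mul _) (.of_forall fun p => ?_)
        simp only
        rw [htel]
        simpa using sq_sum_le_card_mul_sum_sq (s := Finset.range n) (f := fun k => a k p)
    _ = n * ∑ k ∈ Finset.range n, ∫ p, a k p ^ 2 ∂((stdGaussian V).prod (stdGaussian V)) := by
        rw [integral_const_mul, integral_finsetSum _ hint]
    _ ≤ n * ∑ k ∈ Finset.range n, 2 * l ^ 2 * ((1 - Real.cos θ) ^ 2 * n + Real.sin θ ^ 2) := by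
        gcongr with k _
        exact hstep k
    _ = n ^ 2 * (2 * l ^ 2 * ((1 - Real.cos θ) ^ 2 * n + Real.sin θ ^ 2)) := by
        rw [Finset.sum_const, Finset.card_range, nsmul_eq_mul]
        ring
    _ ≤ n ^ 2 * (2 * l ^ 2 * ((θ ^ 2 / 2) ^ 2 * n + θ ^ 2)) := by
        have h1 : 1 - Real.cos θ ≤ θ ^ 2 / 2 := by
          linarith [Real.one_sub_sq_div_two_le_cos (x := θ)]
        have h2 : 0 ≤ 1 - Real.cos θ := by linarith [Real.cos_le_one θ]
        have h3 : Real.sin θ ^ 2 ≤ θ ^ 2 := sq_le_sq.2 (Real.abs_sin_le_abs)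
        gcongr
    _ = 2 * l ^ 2 * ((n * θ) ^ 4 / 4 / n + (n * θ) ^ 2) := by
        field_simp
        ring
    _ ≤ 2 * l ^ 2 * ((8 / 5) ^ 4 / 4 / 1 + (8 / 5) ^ 2) := by
        have : Real.pi / 2 ≤ 8 / 5 := by linarith [Real.pi_lt_d2]
        have := Real.pi_pos
        rw [hnθ]
        gcongr
    _ ≤ 10 * l ^ 2 := by nlinarith [sq_nonneg l]

theorem integral_sub_neg_sq_le (hl : 0 ≤ l) (hF : ConvexOn ℝ Set.univ F)
    (hlip : ∀ x y, |F x - F y| ≤ l * ‖x - y‖) (hd : 1 ≤ Module.finrank ℝ V) :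
    ∫ x : V, (F x - F (-x)) ^ 2 ∂(stdGaussian V) ≤ 40 * l ^ 2 := by
  have hcont := continuous_of_lipschitz hlip
  have hb := integral_sub_sq_le hl hF hlip hd
  have hR := measurePreserving_mixing (V := V) (a := 0) (b := 1) (c := -1) (e := 0)
    (by norm_num) (by norm_num) (by norm_num)
  have hb' : ∫ p : V × V, (F p.2 - F (-p.1)) ^ 2 ∂((stdGaussian V).prod (stdGaussian V))
      ≤ 10 * l ^ 2 := by
    refine le_of_eq_of_le ?_ hb
    rw [← integral_comp_of_measurePreserving hR
      (f := fun p : V × V => (F p.1 - F p.2) ^ 2) (by fun_prop)]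
    simp
  have hm1 : MemLp (fun p : V × V => F p.1) 2 ((stdGaussian V).prod (stdGaussian V)) :=
    (memLp_of_lipschitz hlip).comp_measurePreserving measurePreserving_fst
  have hm2 : MemLp (fun p : V × V => F p.2) 2 ((stdGaussian V).prod (stdGaussian V)) :=
    (memLp_of_lipschitz hlip).comp_measurePreserving measurePreserving_snd
  have hm3 : MemLp (fun p : V × V => F (-p.1)) 2 ((stdGaussian V).prod (stdGaussian V)) := by
    simpa using memLp_combination hlip (a := -1) (b := 0) (by norm_num)
  have i1 := (hm1.sub hm2).integrable_sq
  have i2 := (hm2.sub hm3).integrable_sq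
  simp only [Pi.sub_apply] at i1 i2
  rw [← integral_comp_of_measurePreserving
    (measurePreserving_fst (μ := stdGaussian V) (ν := stdGaussian V))
    (f := fun x : V => (F x - F (-x)) ^ 2) (by fun_prop)]
  calc _ ≤ ∫ p : V × V, (2 * (F p.1 - F p.2) ^ 2 + 2 * (F p.2 - F (-p.1)) ^ 2)
          ∂((stdGaussian V).prod (stdGaussian V)) := by
        refine integral_mono_of_nonneg (.of_forall fun p => sq_nonneg _)
          ((i1.const_mul 2).add (i2.const_mul 2)) (.of_forall fun p => ?_)
        simp only
        nlinarith [sq_nonneg ((F p.1 - F p.2) - (F p.2 - F (-p.1)))]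
    _ ≤ 40 * l ^ 2 := by
        rw [integral_add (i1.const_mul 2) (i2.const_mul 2), integral_const_mul, integral_const_mul]
        linarith

/-- The norm of a standard Gaussian vector is concentrated around the square root of the dimension. -/
theorem integral_norm_div_sqrt_sub_one_sq_le (hd : 1 ≤ Module.finrank ℝ V) :
    ∫ x : V, (1 - ‖x‖ / √(Module.finrank ℝ V)) ^ 2 ∂(stdGaussian V)
      ≤ 10 / (Module.finrank ℝ V : ℝ) := by
  have h := integral_sub_sq_le (V := V) (F := fun x => ‖x‖) (l := 1) zero_le_one
    convexOn_univ_norm (fun x y => by simpa using abs_norm_sub_norm_le x y) hd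
  have hsq := integral_norm_sq_stdGaussian (V := V)
  set n := Module.finrank ℝ V
  have hn1 : (1 : ℝ) ≤ n := by exact_mod_cast hd
  have hN := memLp_norm_stdGaussian (V := V)
  have hN1 := hN.integrable (by simp)
  have hN2 := hN.integrable_sq
  set m := ∫ x : V, ‖x‖ ∂(stdGaussian V) with hm
  have hm0 : 0 ≤ m := integral_nonneg fun x => norm_nonneg x
  have hprod : ∫ p : V × V, (‖p.1‖ - ‖p.2‖) ^ 2 ∂((stdGaussian V).prod (stdGaussian V))
      = 2 * n - 2 * m ^ 2 := by
    have e : ∀ p : V × V, (‖p.1‖ - ‖p.2‖) ^ 2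
        = (‖p.1‖ ^ 2 + ‖p.2‖ ^ 2) - 2 * (‖p.1‖ * ‖p.2‖) := fun p => by ring
    simp_rw [e]
    have hA : Integrable (fun p : V × V => ‖p.1‖ ^ 2 + ‖p.2‖ ^ 2)
        ((stdGaussian V).prod (stdGaussian V)) := (hN2.comp_fst _).add (hN2.comp_snd _)
    rw [integral_sub hA ((hN1.mul_prod hN1).const_mul 2),
      integral_add (hN2.comp_fst _) (hN2.comp_snd _), integral_const_mul, integral_prod_mul,
      integral_fun_fst (fun x : V => ‖x‖ ^ 2), integral_fun_snd (fun x : V => ‖x‖ ^ 2), hsq]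
    simp only [probReal_univ, one_smul, ← hm]
    ring
  rw [hprod] at h
  have hr : √(n : ℝ) ^ 2 = n := Real.sq_sqrt (by positivity)
  have hrpos : 0 < √(n : ℝ) := Real.sqrt_pos.2 (by linarith)
  have hint : ∫ x : V, (1 - ‖x‖ / √n) ^ 2 ∂(stdGaussian V) = 2 * (√n - m) / √n := by
    have e : ∀ x : V, (1 - ‖x‖ / √n) ^ 2 = 1 - 2 / √n * ‖x‖ + (n : ℝ)⁻¹ * ‖x‖ ^ 2 := by
      intro x
      have : (n : ℝ)⁻¹ = (√(n : ℝ))⁻¹ ^ 2 := by rw [inv_pow, hr]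
      rw [this]
      field_simp
      ring
    have hA : Integrable (fun x : V => 1 - 2 / √n * ‖x‖) (stdGaussian V) :=
      (integrable_const _).sub (hN1.const_mul _)
    simp_rw [e]
    rw [integral_add hA (hN2.const_mul _),
      integral_sub (integrable_const _) (hN1.const_mul _), integral_const_mul, integral_const_mul,
      hsq, ← hm]
    simp only [integral_const, probReal_univ, one_smul]
    field_simp
    ring
  rw [hint, div_le_div_iff₀ hrpos (by positivity)]
  rcases le_total (√(n : ℝ)) m with hle | hle
  · nlinarith [mul_nonneg (sub_nonneg.2 hle) (pow_pos hrpos 2).le]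
  · have h1 : (√n - m) * √n ≤ 5 := by nlinarith [mul_nonneg (sub_nonneg.2 hle) hm0]
    nlinarith

end Variance

end Gaussian

/-! ### The polar decomposition of a Gaussian vector -/

theorem charFun_sphere_eq_of_norm_eq {d : ℕ} {a b : E d} (hab : ‖a‖ = ‖b‖) :
    ∫ v : S d, Complex.exp (inner ℝ (v : E d) a * Complex.I) ∂(sphereUniform d)
      = ∫ v : S d, Complex.exp (inner ℝ (v : E d) b * Complex.I) ∂(sphereUniform d) := by
  set A := (Submodule.span ℝ {a - b})ᗮ.reflection with hA
  have hAa : A a = b := Submodule.reflection_sub hab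
  have hmp := measurePreserving_sphereMap A
  rw [← integral_comp_of_measurePreserving hmp
    (f := fun v : S d => Complex.exp (inner ℝ (v : E d) b * Complex.I)) (by fun_prop)]
  simp only [coe_sphereMap, ← hAa, LinearIsometryEquiv.inner_map_map]

theorem measurePreserving_norm_smul {d : ℕ} (hd : 1 ≤ d) :
    MeasurePreserving (fun p : E d × S d => ‖p.1‖ • (p.2 : E d))
      ((stdGaussian (E d)).prod (sphereUniform d)) (stdGaussian (E d)) := by
  have := isProbabilityMeasure_sphereUniform hd
  have hcont : Continuous (fun p : E d × S d => ‖p.1‖ • (p.2 : E d)) := by fun_prop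
  refine ⟨hcont.measurable, ?_⟩
  have : IsFiniteMeasure (((stdGaussian (E d)).prod (sphereUniform d)).map
      (fun p : E d × S d => ‖p.1‖ • (p.2 : E d))) := Measure.isFiniteMeasure_map _ _
  refine Measure.ext_of_charFun ?_
  funext t
  have hbdd : ∀ f : E d × S d → ℝ, Continuous f →
      Integrable (fun p => Complex.exp (f p * Complex.I))
        ((stdGaussian (E d)).prod (sphereUniform d)) := by
    intro f hf
    refine (integrable_const (1 : ℝ)).mono' (by fun_prop) (.of_forall fun p => ?_)
    rw [Complex.norm_exp_ofReal_mul_I]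
  rw [charFun_apply, integral_map hcont.measurable.aemeasurable (by fun_prop),
    integral_prod _ (hbdd (fun p => inner ℝ (‖p.1‖ • (p.2 : E d)) t) (by fun_prop))]
  -- The mean over `v` depends only on the norm `‖x‖ ‖t‖`, so the roles of `x` and `t` can be exchanged.
  have h1 : ∀ x : E d, ∫ v : S d, Complex.exp (inner ℝ (‖x‖ • (v : E d)) t * Complex.I)
        ∂(sphereUniform d)
      = ∫ v : S d, Complex.exp (inner ℝ x (‖t‖ • (v : E d)) * Complex.I) ∂(sphereUniform d) := by
    intro x
    have h := charFun_sphere_eq_of_norm_eq (a := ‖x‖ • t) (b := ‖t‖ • x)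
      (by simp [norm_smul, mul_comm])
    convert h using 5 with v v
    · rw [inner_smul_left, inner_smul_right]
      simp
    · rw [inner_smul_right, inner_smul_right, real_inner_comm]
  simp only [h1]
  rw [← integral_prod (fun p : E d × S d =>
      Complex.exp (inner ℝ p.1 (‖t‖ • (p.2 : E d)) * Complex.I)) (hbdd _ (by fun_prop)),
    integral_prod_symm _ (hbdd _ (by fun_prop))]
  have h2 : ∀ v : S d, ∫ x : E d, Complex.exp (inner ℝ x (‖t‖ • (v : E d)) * Complex.I)
      ∂(stdGaussian (E d)) = charFun (stdGaussian (E d)) t := by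
    intro v
    rw [← charFun_apply, charFun_stdGaussian, charFun_stdGaussian]
    simp [norm_smul]
  simp [h2]

/-- Concentration on the sphere: for a convex `l`-Lipschitz function, the second moment of
`F v - F (-v)` is of order `l² / d`. -/
theorem integral_sphere_sub_neg_sq_le {d : ℕ} (hd : 1 ≤ d) {F : E d → ℝ} {l : ℝ} (hl : 0 ≤ l)
    (hF : ConvexOn ℝ Set.univ F) (hlip : ∀ x y, |F x - F y| ≤ l * ‖x - y‖) :
    ∫ v : S d, (F v - F (-v)) ^ 2 ∂(sphereUniform d) ≤ 180 * l ^ 2 / d := by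
  have := isProbabilityMeasure_sphereUniform hd
  have hcont := continuous_of_lipschitz hlip
  have hfin : Module.finrank ℝ (E d) = d := by simp
  have hdpos : (0 : ℝ) < d := by exact_mod_cast hd
  have hr : √(d : ℝ) ^ 2 = d := Real.sq_sqrt hdpos.le
  have hrpos : 0 < √(d : ℝ) := Real.sqrt_pos.2 hdpos
  set H : E d → ℝ := fun x => F ((√(d : ℝ))⁻¹ • x) with hH
  have hHlip : ∀ x y, |H x - H y| ≤ l / √d * ‖x - y‖ := by
    intro x y
    have := hlip ((√(d : ℝ))⁻¹ • x) ((√(d : ℝ))⁻¹ • y)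
    rw [← smul_sub, norm_smul, norm_inv, Real.norm_of_nonneg hrpos.le] at this
    calc _ ≤ _ := this
      _ = _ := by ring
  have hHconv : ConvexOn ℝ Set.univ H := by
    refine ⟨convex_univ, fun x _ y _ a b ha hb hab => ?_⟩
    have := hF.2 (Set.mem_univ ((√(d : ℝ))⁻¹ • x)) (Set.mem_univ ((√(d : ℝ))⁻¹ • y)) ha hb hab
    have e : (√(d : ℝ))⁻¹ • (a • x + b • y)
        = a • (√(d : ℝ))⁻¹ • x + b • (√(d : ℝ))⁻¹ • y := by module
    simp only [hH]
    rw [e]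
    exact this
  have hgauss := integral_sub_neg_sq_le (div_nonneg hl hrpos.le) hHconv hHlip (by rw [hfin]; exact hd)
  have hrad := integral_norm_div_sqrt_sub_one_sq_le (V := E d) (by rw [hfin]; exact hd)
  rw [hfin] at hrad
  have hHc : Continuous H := continuous_of_lipschitz hHlip
  have hmp := measurePreserving_norm_smul hd
  rw [← integral_comp_of_measurePreserving hmp
    (f := fun z : E d => (H z - H (-z)) ^ 2) (by fun_prop)] at hgauss
  have hHm : MemLp (fun z => H z - H (-z)) 2 (stdGaussian (E d)) := by
    refine (memLp_of_lipschitz hHlip).sub (memLp_of_lipschitz (F := fun z => H (-z)) (l := l / √d)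
      fun x y => ?_)
    have := hHlip (-x) (-y)
    rwa [← neg_sub', norm_neg] at this
  have i2 : Integrable
      (fun p : E d × S d => (H (‖p.1‖ • (p.2 : E d)) - H (-(‖p.1‖ • (p.2 : E d)))) ^ 2)
      ((stdGaussian (E d)).prod (sphereUniform d)) :=
    (hHm.comp_measurePreserving hmp).integrable_sq
  have i1 : Integrable (fun x : E d => (1 - ‖x‖ / √d) ^ 2) (stdGaussian (E d)) := by
    refine MemLp.integrable_sq ((memLp_const 1).sub ?_)
    simpa [div_eq_mul_inv, mul_comm] using
      (memLp_norm_stdGaussian (V := E d)).const_mul ((√(d : ℝ))⁻¹)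
  have i1' := i1.comp_fst (sphereUniform d)
  -- With `ρ = ‖x‖ / √d` close to `1`, pass from `v` to `ρ v` and from `-ρ v` to `-v`.
  calc ∫ v : S d, (F v - F (-v)) ^ 2 ∂(sphereUniform d)
      = ∫ p : E d × S d, (F p.2 - F (-p.2)) ^ 2
          ∂((stdGaussian (E d)).prod (sphereUniform d)) := by
        rw [integral_fun_snd (fun v : S d => (F v - F (-v)) ^ 2)]
        simp
    _ ≤ ∫ p : E d × S d, (6 * l ^ 2 * (1 - ‖p.1‖ / √d) ^ 2
          + 3 * (H (‖p.1‖ • (p.2 : E d)) - H (-(‖p.1‖ • (p.2 : E d)))) ^ 2)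
          ∂((stdGaussian (E d)).prod (sphereUniform d)) := by
        refine integral_mono_of_nonneg (.of_forall fun p => sq_nonneg _)
          ((i1'.const_mul _).add (i2.const_mul 3)) (.of_forall fun p => ?_)
        set v : E d := (p.2 : E d) with hv
        have hv1 : ‖v‖ = 1 := by simp [hv]
        set ρ := ‖p.1‖ / √(d : ℝ) with hρ
        have e1 : H (‖p.1‖ • v) = F (ρ • v) := by
          simp only [hH, smul_smul]
          rw [hρ, div_eq_inv_mul]
        have e2 : H (-(‖p.1‖ • v)) = F (-(ρ • v)) := by
          simp only [hH, smul_neg, smul_smul]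
          rw [hρ, div_eq_inv_mul]
        have h1 : (F v - F (ρ • v)) ^ 2 ≤ l ^ 2 * (1 - ρ) ^ 2 := by
          have := hlip v (ρ • v)
          have e : v - ρ • v = (1 - ρ) • v := by module
          rw [e, norm_smul, hv1, mul_one, Real.norm_eq_abs] at this
          rw [← mul_pow, ← sq_abs, ← sq_abs (l * _), abs_mul, abs_of_nonneg hl]
          gcongr
        have h3 : (F (-(ρ • v)) - F (-v)) ^ 2 ≤ l ^ 2 * (1 - ρ) ^ 2 := by
          have := hlip (-(ρ • v)) (-v)
          have e : -(ρ • v) - -v = (1 - ρ) • v := by module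
          rw [e, norm_smul, hv1, mul_one, Real.norm_eq_abs] at this
          rw [← mul_pow, ← sq_abs, ← sq_abs (l * _), abs_mul, abs_of_nonneg hl]
          gcongr
        simp only
        rw [e1, e2]
        set A := F v - F (ρ • v)
        set B := F (ρ • v) - F (-(ρ • v))
        set C := F (-(ρ • v)) - F (-v)
        have e3 : F v - F (-v) = A + B + C := by simp only [A, B, C]; ring
        rw [e3]
        nlinarith [sq_nonneg (A - B), sq_nonneg (B - C), sq_nonneg (A - C)]
    _ = 6 * l ^ 2 * ∫ x : E d, (1 - ‖x‖ / √d) ^ 2 ∂(stdGaussian (E d))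
          + 3 * ∫ p : E d × S d, (H (‖p.1‖ • (p.2 : E d)) - H (-(‖p.1‖ • (p.2 : E d)))) ^ 2
          ∂((stdGaussian (E d)).prod (sphereUniform d)) := by
        rw [integral_add (i1'.const_mul _) (i2.const_mul 3), integral_const_mul, integral_const_mul,
          integral_fun_fst (fun x : E d => (1 - ‖x‖ / √d) ^ 2)]
        simp
    _ ≤ 6 * l ^ 2 * (10 / d) + 3 * (40 * (l / √d) ^ 2) := by gcongr
    _ = 180 * l ^ 2 / d := by
        rw [div_pow, hr]
        ring

/-! ### Moments of the two-point estimator -/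

section TwoPoint

variable {d : ℕ} {F : E d → ℝ} {L δ : ℝ}


theorem norm_twoPoint (hδ : 0 < δ) (x : E d) (v : S d) :
    ‖twoPoint δ F x v‖ = d / (2 * δ) * |F (x + δ • (v : E d)) - F (x - δ • (v : E d))| := by
  unfold twoPoint
  rw [norm_smul, norm_mul, Real.norm_of_nonneg (by positivity)]
  simp

theorem norm_twoPoint_le (hδ : 0 < δ) (hlip : ∀ x y, |F x - F y| ≤ L * ‖x - y‖) (x : E d)
    (v : S d) : ‖twoPoint δ F x v‖ ≤ d * L := by
  rw [norm_twoPoint hδ]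
  have h := hlip (x + δ • (v : E d)) (x - δ • (v : E d))
  have e : x + δ • (v : E d) - (x - δ • (v : E d)) = (2 * δ) • (v : E d) := by module
  rw [e, norm_smul, Real.norm_of_nonneg (by positivity)] at h
  simp only [norm_eq_of_mem_sphere, mul_one] at h
  calc _ ≤ d / (2 * δ) * (L * (2 * δ)) := by gcongr
    _ = d * L := by field_simp

theorem convexOn_rescale (hF : ConvexOn ℝ Set.univ F) (x : E d) :
    ConvexOn ℝ Set.univ (fun z => F (x + δ • z)) := by
  refine ⟨convex_univ, fun z _ w _ a b ha hb hab => ?_⟩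
  have h := hF.2 (Set.mem_univ (x + δ • z)) (Set.mem_univ (x + δ • w)) ha hb hab
  have e : x + δ • (a • z + b • w) = a • (x + δ • z) + b • (x + δ • w) := by
    have : x = (a + b) • x := by rw [hab, one_smul]
    nth_rewrite 1 [this]
    module
  simp only
  rw [e]
  exact h

theorem lipschitz_rescale (hδ : 0 < δ) (hlip : ∀ x y, |F x - F y| ≤ L * ‖x - y‖) (x z w : E d) :
    |F (x + δ • z) - F (x + δ • w)| ≤ δ * L * ‖z - w‖ := by
  have h := hlip (x + δ • z) (x + δ • w)
  rw [add_sub_add_left_eq_sub, ← smul_sub, norm_smul, Real.norm_of_nonneg hδ.le] at h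
  linarith

theorem integral_norm_twoPoint_sq_le (hd : 1 ≤ d) (hL : 0 ≤ L) (hδ : 0 < δ)
    (hF : ConvexOn ℝ Set.univ F) (hlip : ∀ x y, |F x - F y| ≤ L * ‖x - y‖) (x : E d) :
    ∫ v, ‖twoPoint δ F x v‖ ^ 2 ∂(sphereUniform d) ≤ 45 * d * L ^ 2 := by
  have hdpos : (0 : ℝ) < d := by exact_mod_cast hd
  have h := integral_sphere_sub_neg_sq_le hd (mul_nonneg hδ.le hL) (convexOn_rescale hF x)
    (lipschitz_rescale hδ hlip x)
  calc ∫ v, ‖twoPoint δ F x v‖ ^ 2 ∂(sphereUniform d)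
      = (d / (2 * δ)) ^ 2 * ∫ v : S d, (F (x + δ • (v : E d)) - F (x + δ • (-(v : E d)))) ^ 2
          ∂(sphereUniform d) := by
        rw [← integral_const_mul]
        refine integral_congr_ae (.of_forall fun v => ?_)
        simp only
        rw [norm_twoPoint hδ, mul_pow, sq_abs, smul_neg, ← sub_eq_add_neg]
    _ ≤ (d / (2 * δ)) ^ 2 * (180 * (δ * L) ^ 2 / d) := by gcongr
    _ = 45 * d * L ^ 2 := by
        field_simp
        ring

/-- The mean of the two-point estimator is a subgradient up to an error of `2 L δ`. -/
theorem le_integral_inner_twoPoint (hd : 1 ≤ d) (hL : 0 ≤ L) (hδ : 0 < δ)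
    (hF : ConvexOn ℝ Set.univ F) (hlip : ∀ x y, |F x - F y| ≤ L * ‖x - y‖) (x y : E d) :
    F x - F y - 2 * L * δ ≤ ∫ v, inner ℝ (twoPoint δ F x v) (x - y) ∂(sphereUniform d) := by
  have := isProbabilityMeasure_sphereUniform hd
  have hcont := continuous_of_lipschitz hlip
  have h := flux_le hd (mul_nonneg hδ.le hL) (convexOn_rescale hF x)
    (lipschitz_rescale hδ hlip x) (δ⁻¹ • (y - x))
  have e1 : x + δ • δ⁻¹ • (y - x) = y := by
    rw [smul_smul, mul_inv_cancel₀ hδ.ne', one_smul, add_sub_cancel]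
  simp only [e1, smul_zero, add_zero] at h
  set φ : S d → ℝ := fun v => F (x + δ • (v : E d)) * inner ℝ (v : E d) (δ⁻¹ • (y - x)) with hφ
  have hφc : Continuous φ := by fun_prop
  have hint : ∀ ψ : S d → ℝ, Continuous ψ → Integrable ψ (sphereUniform d) := fun ψ hψ =>
    hψ.integrable_of_hasCompactSupport (HasCompactSupport.of_compactSpace _)
  have hneg := integral_comp_of_measurePreserving (measurePreserving_neg_sphereUniform d)
    (f := φ) hφc.aestronglyMeasurable
  have e : ∀ v : S d, inner ℝ (twoPoint δ F x v) (x - y) = (-(d : ℝ) / 2) * (φ v + φ (-v)) := by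
    intro v
    simp only [hφ, twoPoint, inner_smul_left, inner_smul_right, inner_sub_right, coe_neg_sphere,
      inner_neg_left, smul_neg, conj_trivial, ← sub_eq_add_neg]
    field_simp
    ring
  simp_rw [e]
  rw [integral_const_mul, integral_add (hint _ hφc) (hint _ (by fun_prop)), hneg]
  linarith

end TwoPoint

/-! ### Lazy estimators -/

section Lazy

variable {d : ℕ}

theorem mem_symmetricCore {A : Set (S d)} {v : S d} :
    v ∈ symmetricCore A ↔ v ∈ A ∧ -v ∈ A := by
  constructor
  · rintro ⟨B, ⟨hBA, hB⟩, hv⟩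
    exact ⟨hBA hv, hBA ((hB v).1 hv)⟩
  · rintro ⟨h1, h2⟩
    refine ⟨{w | w ∈ A ∧ -w ∈ A}, ⟨fun w hw => hw.1, fun w => ?_⟩, h1, h2⟩
    simp only [Set.mem_ofPred_eq, neg_neg]
    exact and_comm

/-- What the estimator of round `t` depends on besides the current direction: the current iterate and
the previous query point. In round `0` the second component is a dummy value. -/
noncomputable def state (rule : Rule d) (X : Set (E d)) (f : ℕ → E d → ℝ) (x₀ : E d) (η δ : ℝ)
    (u : ℕ → S d) : ℕ → E d × E d
  | 0 => (x₀, 0)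
  | t + 1 => (iterate rule X f x₀ η δ u (t + 1), iterate rule X f x₀ η δ u t + δ • (u t : E d))

/-- The directions of round `t` that reuse the previous query in state `z`. -/
def stateRegion (rule : Rule d) (f : ℕ → E d → ℝ) (δ : ℝ) : ℕ → E d × E d → Set (S d)
  | 0, _ => ∅
  | t + 1, z => {v | rule (f (t + 1)) (f t) (z.1 + δ • (v : E d)) z.2}

/-- The gradient estimator of round `t` as a function of the state and of the direction. -/
noncomputable def stateEstimator (rule : Rule d) (f : ℕ → E d → ℝ) (δ : ℝ) :
    ℕ → E d × E d → S d → E d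
  | 0, z, v => twoPoint δ (f 0) z.1 v
  | t + 1, z, v => lazyEstimator rule δ (f (t + 1)) (f t) z.1 v z.2

/-- The difference between the one-point and the two-point estimator, an odd function of the
direction. -/
noncomputable def residual (f : ℕ → E d → ℝ) (δ : ℝ) : ℕ → E d × E d → S d → E d
  | 0, _, _ => 0
  | t + 1, z, v => onePoint δ (f (t + 1)) (f t) z.1 v z.2 - twoPoint δ (f (t + 1)) z.1 v

variable {rule : Rule d} {X : Set (E d)} {f : ℕ → E d → ℝ} {x₀ : E d} {η δ : ℝ}

theorem reuseRegion_eq (u : ℕ → S d) (t : ℕ) :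
    reuseRegion rule X f x₀ η δ u t = stateRegion rule f δ t (state rule X f x₀ η δ u t) := by
  cases t <;> rfl

theorem fst_state (u : ℕ → S d) (t : ℕ) :
    (state rule X f x₀ η δ u t).1 = iterate rule X f x₀ η δ u t := by
  cases t <;> rfl

theorem iterate_succ (u : ℕ → S d) (t : ℕ) :
    iterate rule X f x₀ η δ u (t + 1) = proj X (iterate rule X f x₀ η δ u t
      - η • stateEstimator rule f δ t (state rule X f x₀ η δ u t) (u t)) := by
  cases t <;> rfl

theorem state_succ (u : ℕ → S d) (t : ℕ) :
    state rule X f x₀ η δ u (t + 1) = (proj X (iterate rule X f x₀ η δ u t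
      - η • stateEstimator rule f δ t (state rule X f x₀ η δ u t) (u t)),
      iterate rule X f x₀ η δ u t + δ • (u t : E d)) := by
  rw [← iterate_succ]
  rfl

theorem iterate_mem (hX : IsClosed X) (hx₀ : x₀ ∈ X) (u : ℕ → S d) (t : ℕ) :
    iterate rule X f x₀ η δ u t ∈ X := by
  cases t with
  | zero => exact hx₀
  | succ t =>
    rw [iterate_succ]
    exact proj_mem hX ⟨x₀, hx₀⟩ _

theorem stateEstimator_of_mem {t : ℕ} {z : E d × E d} {v : S d}
    (h : v ∈ stateRegion rule f δ t z) :
    stateEstimator rule f δ t z v = twoPoint δ (f t) z.1 v + residual f δ t z v := by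
  cases t with
  | zero => exact absurd h (Set.notMem_empty _)
  | succ t =>
    simp only [stateEstimator, residual, lazyEstimator]
    rw [if_pos (show rule (f (t + 1)) (f t) (z.1 + δ • (v : E d)) z.2 from h)]
    abel

theorem stateEstimator_of_notMem {t : ℕ} {z : E d × E d} {v : S d}
    (h : v ∉ stateRegion rule f δ t z) :
    stateEstimator rule f δ t z v = twoPoint δ (f t) z.1 v := by
  cases t with
  | zero => rfl
  | succ t =>
    simp only [stateEstimator, lazyEstimator]
    rw [if_neg (show ¬ rule (f (t + 1)) (f t) (z.1 + δ • (v : E d)) z.2 from h)]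

theorem residual_neg (t : ℕ) (z : E d × E d) (v : S d) :
    residual f δ t z (-v) = -residual f δ t z v := by
  cases t with
  | zero => simp [residual]
  | succ t =>
    have h1 : z.1 + δ • -(v : E d) = z.1 - δ • (v : E d) := by module
    have h2 : z.1 - δ • -(v : E d) = z.1 + δ • (v : E d) := by module
    simp only [residual, onePoint, twoPoint, coe_neg_sphere, h1, h2]
    module

/-! ### Measurability -/

theorem measurable_residual (hf : ∀ t, Continuous (f t)) (t : ℕ) :
    Measurable (fun p : (E d × E d) × S d => residual f δ t p.1 p.2) := by
  cases t with
  | zero => exact measurable_const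
  | succ t =>
    have h1 := hf (t + 1)
    have h0 := hf t
    simp only [residual, onePoint, twoPoint]
    exact Continuous.measurable (by fun_prop)

theorem measurable_twoPoint (hf : ∀ t, Continuous (f t)) (t : ℕ) :
    Measurable (fun p : (E d × E d) × S d => twoPoint δ (f t) p.1.1 p.2) := by
  have h1 := hf t
  simp only [twoPoint]
  exact Continuous.measurable (by fun_prop)

theorem measurableSet_stateRegion (hf : ∀ t, Continuous (f t))
    (hrule : ∀ g g' : E d → ℝ, Continuous g → Continuous g' →
      MeasurableSet {p : E d × E d | rule g g' p.1 p.2}) (t : ℕ) :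
    MeasurableSet {p : (E d × E d) × S d | p.2 ∈ stateRegion rule f δ t p.1} := by
  cases t with
  | zero => simp [stateRegion]
  | succ t =>
    have hm : Measurable fun p : (E d × E d) × S d => (p.1.1 + δ • (p.2 : E d), p.1.2) :=
      Continuous.measurable (by fun_prop)
    exact hm (hrule _ _ (hf (t + 1)) (hf t))

theorem measurableSet_symmetricCore_stateRegion (hf : ∀ t, Continuous (f t))
    (hrule : ∀ g g' : E d → ℝ, Continuous g → Continuous g' →
      MeasurableSet {p : E d × E d | rule g g' p.1 p.2}) (t : ℕ) :
    MeasurableSet {p : (E d × E d) × S d | p.2 ∈ symmetricCore (stateRegion rule f δ t p.1)} := by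
  have h := measurableSet_stateRegion (δ := δ) hf hrule t
  have hm : Measurable fun p : (E d × E d) × S d => (p.1, -p.2) := Continuous.measurable (by fun_prop)
  have e : {p : (E d × E d) × S d | p.2 ∈ symmetricCore (stateRegion rule f δ t p.1)}
      = {p | p.2 ∈ stateRegion rule f δ t p.1}
        ∩ (fun p : (E d × E d) × S d => (p.1, -p.2)) ⁻¹' {p | p.2 ∈ stateRegion rule f δ t p.1} := by
    ext p
    exact mem_symmetricCore
  rw [e]
  exact h.inter (hm h)

theorem measurable_stateEstimator (hf : ∀ t, Continuous (f t))
    (hrule : ∀ g g' : E d → ℝ, Continuous g → Continuous g' →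
      MeasurableSet {p : E d × E d | rule g g' p.1 p.2}) (t : ℕ) :
    Measurable (fun p : (E d × E d) × S d => stateEstimator rule f δ t p.1 p.2) := by
  classical
  have e : (fun p : (E d × E d) × S d => stateEstimator rule f δ t p.1 p.2)
      = fun p => if p ∈ {p : (E d × E d) × S d | p.2 ∈ stateRegion rule f δ t p.1} then
        twoPoint δ (f t) p.1.1 p.2 + residual f δ t p.1 p.2 else twoPoint δ (f t) p.1.1 p.2 := by
    funext p
    split_ifs with h
    · exact stateEstimator_of_mem h
    · exact stateEstimator_of_notMem h
  rw [e]
  exact Measurable.ite (measurableSet_stateRegion hf hrule t)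
    ((measurable_twoPoint hf t).add (measurable_residual hf t)) (measurable_twoPoint hf t)

theorem measurable_state (hX : IsClosed X) (hconv : Convex ℝ X) (hx₀ : x₀ ∈ X)
    (hf : ∀ t, Continuous (f t))
    (hrule : ∀ g g' : E d → ℝ, Continuous g → Continuous g' →
      MeasurableSet {p : E d × E d | rule g g' p.1 p.2}) (t : ℕ) :
    Measurable (fun u : ℕ → S d => state rule X f x₀ η δ u t) := by
  induction t with
  | zero => exact measurable_const
  | succ t ih =>
    have hit : Measurable (fun u : ℕ → S d => iterate rule X f x₀ η δ u t) := by
      simpa only [fst_state] using ih.fst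
    have hest : Measurable (fun u : ℕ → S d =>
        stateEstimator rule f δ t (state rule X f x₀ η δ u t) (u t)) :=
      (measurable_stateEstimator hf hrule t).comp (ih.prodMk (measurable_pi_apply t))
    simp only [state_succ]
    exact ((continuous_proj hX hconv ⟨x₀, hx₀⟩).measurable.comp
      (hit.sub (hest.const_smul η))).prodMk
      (hit.add ((measurable_subtype_coe.comp (measurable_pi_apply t)).const_smul δ))

theorem state_congr {u u' : ℕ → S d} {t : ℕ} (h : ∀ s < t, u s = u' s) :
    state rule X f x₀ η δ u t = state rule X f x₀ η δ u' t := by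
  induction t with
  | zero => rfl
  | succ t ih =>
    have ih' := ih fun s hs => h s (by omega)
    have hi : iterate rule X f x₀ η δ u t = iterate rule X f x₀ η δ u' t := by
      rw [← fst_state, ih', fst_state]
    rw [state_succ, state_succ, hi, ih', h t (by omega)]

end Lazy

/-! ### Conditioning on the past -/

section Independence

variable {Ω : Type*} [MeasurableSpace Ω] {P : Measure Ω} [IsProbabilityMeasure P]

/-- For independent `Z` and `U`, the variable `U` can be integrated out first. -/
theorem integral_of_indepFun {α β : Type*} [MeasurableSpace α] [MeasurableSpace β] {Z : Ω → α}
    {U : Ω → β} (hZ : Measurable Z) (hU : Measurable U) (h : IndepFun Z U P) {φ : α × β → ℝ}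
    (hφ : Measurable φ) (hint : Integrable (fun ω => φ (Z ω, U ω)) P) :
    Integrable (fun ω => ∫ v, φ (Z ω, v) ∂(P.map U)) P ∧
      ∫ ω, φ (Z ω, U ω) ∂P = ∫ ω, ∫ v, φ (Z ω, v) ∂(P.map U) ∂P := by
  have := Measure.isProbabilityMeasure_map (μ := P) hU.aemeasurable
  have := Measure.isProbabilityMeasure_map (μ := P) hZ.aemeasurable
  have hmap := (indepFun_iff_map_prod_eq_prod_map_map hZ.aemeasurable hU.aemeasurable).1 h
  have hprod : Integrable φ ((P.map Z).prod (P.map U)) := by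
    rw [← hmap]
    exact (integrable_map_measure hφ.aestronglyMeasurable (hZ.prodMk hU).aemeasurable).2 hint
  have hinner : AEStronglyMeasurable (fun z => ∫ v, φ (z, v) ∂(P.map U)) (P.map Z) :=
    hprod.integral_prod_left.aestronglyMeasurable
  refine ⟨(integrable_map_measure hinner hZ.aemeasurable).1 hprod.integral_prod_left, ?_⟩
  rw [← integral_map (f := φ) (hZ.prodMk hU).aemeasurable hφ.aestronglyMeasurable, hmap,
    integral_prod _ hprod, integral_map hZ.aemeasurable hinner]

variable {d : ℕ} {rule : Rule d} {X : Set (E d)} {f : ℕ → E d → ℝ} {x₀ : E d} {η δ : ℝ}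
  {U : ℕ → Ω → S d}

theorem indepFun_state (hX : IsClosed X) (hconv : Convex ℝ X) (hx₀ : x₀ ∈ X)
    (hf : ∀ t, Continuous (f t))
    (hrule : ∀ g g' : E d → ℝ, Continuous g → Continuous g' →
      MeasurableSet {p : E d × E d | rule g g' p.1 p.2})
    (hU : ∀ t, Measurable (U t)) (hind : iIndepFun U P) (t : ℕ) :
    IndepFun (fun ω => state rule X f x₀ η δ (fun s => U s ω) t) (U t) P := by
  classical
  obtain ⟨ω₀⟩ : Nonempty Ω := nonempty_of_isProbabilityMeasure P
  have h := hind.indepFun_finset (Finset.range t) {t} (by simp) hU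
  -- The directions before round `t`, continued by a constant, determine the state.
  let pad : (Finset.range t → S d) → ℕ → S d := fun w s =>
    if hs : s ∈ Finset.range t then w ⟨s, hs⟩ else U 0 ω₀
  have hpad : Measurable pad := by
    refine measurable_pi_lambda _ fun s => ?_
    by_cases hs : s ∈ Finset.range t
    · simp only [pad, dif_pos hs]
      exact measurable_pi_apply _
    · simp only [pad, dif_neg hs]
      exact measurable_const
  have h' := h.comp ((measurable_state (η := η) (δ := δ) hX hconv hx₀ hf hrule t).comp hpad)
    (measurable_pi_apply (⟨t, by simp⟩ : ({t} : Finset ℕ)))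
  have e : (fun ω => state rule X f x₀ η δ (fun s => U s ω) t)
      = ((fun u => state rule X f x₀ η δ u t) ∘ pad) ∘ fun ω (i : Finset.range t) => U i ω := by
    funext ω
    exact state_congr fun s hs => by simp [pad, hs]
  rw [e]
  exact h'

end Independence

/-! ### Regret of projected stochastic descent with a lazy estimator -/

section Regret

variable {d : ℕ} {rule : Rule d} {X : Set (E d)} {f : ℕ → E d → ℝ} {x₀ : E d} {η δ R L : ℝ}

/-- The gradient estimate used in round `t`. -/
noncomputable def gradient (rule : Rule d) (X : Set (E d)) (f : ℕ → E d → ℝ) (x₀ : E d) (η δ : ℝ)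
    (u : ℕ → S d) (t : ℕ) : E d :=
  stateEstimator rule f δ t (state rule X f x₀ η δ u t) (u t)

theorem sum_inner_gradient_le (hX : IsClosed X) (hconv : Convex ℝ X) (hη : 0 < η)
    {y : E d} (hy : y ∈ X) (u : ℕ → S d) (n : ℕ) :
    ∑ t ∈ Finset.range n,
        inner ℝ (gradient rule X f x₀ η δ u t) (iterate rule X f x₀ η δ u t - y)
      ≤ ‖x₀ - y‖ ^ 2 / (2 * η)
        + η / 2 * ∑ t ∈ Finset.range n, ‖gradient rule X f x₀ η δ u t‖ ^ 2 := by
  suffices h : ∑ t ∈ Finset.range n,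
        inner ℝ (gradient rule X f x₀ η δ u t) (iterate rule X f x₀ η δ u t - y)
      ≤ (‖x₀ - y‖ ^ 2 - ‖iterate rule X f x₀ η δ u n - y‖ ^ 2) / (2 * η)
        + η / 2 * ∑ t ∈ Finset.range n, ‖gradient rule X f x₀ η δ u t‖ ^ 2 by
    refine h.trans ?_
    gcongr
    linarith [sq_nonneg ‖iterate rule X f x₀ η δ u n - y‖]
  induction n with
  | zero => simp [iterate]
  | succ n ih =>
    rw [Finset.sum_range_succ, Finset.sum_range_succ]
    have h1 := norm_proj_sub_le hX hconv
      (iterate rule X f x₀ η δ u n - η • gradient rule X f x₀ η δ u n) hy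
    have h2 : iterate rule X f x₀ η δ u (n + 1)
        = proj X (iterate rule X f x₀ η δ u n - η • gradient rule X f x₀ η δ u n) :=
      iterate_succ u n
    rw [← h2] at h1
    set x := iterate rule X f x₀ η δ u n
    set x' := iterate rule X f x₀ η δ u (n + 1)
    set g := gradient rule X f x₀ η δ u n
    have h3 : ‖x' - y‖ ^ 2 ≤ ‖x - y‖ ^ 2 - 2 * η * inner ℝ g (x - y) + η ^ 2 * ‖g‖ ^ 2 := by
      calc ‖x' - y‖ ^ 2 ≤ ‖x - η • g - y‖ ^ 2 := by gcongr
        _ = ‖(x - y) - η • g‖ ^ 2 := by congr 2; abel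
        _ = _ := by
          rw [norm_sub_sq_real, inner_smul_right, norm_smul, real_inner_comm, mul_pow,
            Real.norm_eq_abs, sq_abs]
          ring
    have h4 : inner ℝ g (x - y) ≤ (‖x - y‖ ^ 2 - ‖x' - y‖ ^ 2) / (2 * η) + η / 2 * ‖g‖ ^ 2 := by
      rw [← sub_le_iff_le_add, le_div_iff₀ (by positivity)]
      nlinarith
    calc _ ≤ _ := add_le_add ih h4
      _ = _ := by ring

theorem norm_sub_le_of_subset (hR : X ⊆ Metric.closedBall 0 R) {x y : E d} (hx : x ∈ X)
    (hy : y ∈ X) : ‖x - y‖ ≤ 2 * R := by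
  have h1 := mem_closedBall_zero_iff.1 (hR hx)
  have h2 := mem_closedBall_zero_iff.1 (hR hy)
  linarith [norm_sub_le x y]

section Probability

variable {Ω : Type*} [MeasurableSpace Ω] {P : Measure Ω} [IsProbabilityMeasure P] {U : ℕ → Ω → S d}

theorem measurable_gradient (hX : IsClosed X) (hconv : Convex ℝ X) (hx₀ : x₀ ∈ X)
    (hf : ∀ t, Continuous (f t))
    (hrule : ∀ g g' : E d → ℝ, Continuous g → Continuous g' →
      MeasurableSet {p : E d × E d | rule g g' p.1 p.2})
    (hU : ∀ t, Measurable (U t)) (t : ℕ) :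
    Measurable (fun ω => gradient rule X f x₀ η δ (fun s => U s ω) t) :=
  (measurable_stateEstimator hf hrule t).comp
    (((measurable_state hX hconv hx₀ hf hrule t).comp (measurable_pi_lambda _ hU)).prodMk (hU t))

theorem measurable_iterate (hX : IsClosed X) (hconv : Convex ℝ X) (hx₀ : x₀ ∈ X)
    (hf : ∀ t, Continuous (f t))
    (hrule : ∀ g g' : E d → ℝ, Continuous g → Continuous g' →
      MeasurableSet {p : E d × E d | rule g g' p.1 p.2})
    (hU : ∀ t, Measurable (U t)) (t : ℕ) :
    Measurable (fun ω => iterate rule X f x₀ η δ (fun s => U s ω) t) := by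
  simpa only [fst_state, Function.comp_def] using
    ((measurable_state (η := η) (δ := δ) hX hconv hx₀ hf hrule t).comp
      (measurable_pi_lambda _ hU)).fst

theorem integrable_of_bound {g : Ω → ℝ} (hg : Measurable g) {C : ℝ} (h : ∀ ω, |g ω| ≤ C) :
    Integrable g P :=
  (integrable_const C).mono' hg.aestronglyMeasurable (.of_forall h)

theorem integrable_loss (hX : IsClosed X) (hconv : Convex ℝ X) (hx₀ : x₀ ∈ X)
    (hR : X ⊆ Metric.closedBall 0 R) (hL : 0 ≤ L)
    (hlip : ∀ t x y, |f t x - f t y| ≤ L * ‖x - y‖)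
    (hrule : ∀ g g' : E d → ℝ, Continuous g → Continuous g' →
      MeasurableSet {p : E d × E d | rule g g' p.1 p.2})
    (hU : ∀ t, Measurable (U t)) (t : ℕ) :
    Integrable (fun ω => f t (iterate rule X f x₀ η δ (fun s => U s ω) t)) P := by
  have hf : ∀ t, Continuous (f t) := fun t => continuous_of_lipschitz (hlip t)
  refine integrable_of_bound ((hf t).measurable.comp
    (measurable_iterate hX hconv hx₀ hf hrule hU t)) (C := |f t x₀| + L * (2 * R)) fun ω => ?_
  have hm := iterate_mem (rule := rule) (f := f) (η := η) (δ := δ) hX hx₀ (fun s => U s ω) t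
  have h1 := hlip t (iterate rule X f x₀ η δ (fun s => U s ω) t) x₀
  have h2 := norm_sub_le_of_subset hR hm hx₀
  have h3 := abs_sub_abs_le_abs_sub (f t (iterate rule X f x₀ η δ (fun s => U s ω) t)) (f t x₀)
  have h4 := mul_le_mul_of_nonneg_left h2 hL
  linarith

theorem integrable_inner_gradient (hX : IsClosed X) (hconv : Convex ℝ X) (hx₀ : x₀ ∈ X)
    (hR : X ⊆ Metric.closedBall 0 R) (hf : ∀ t, Continuous (f t))
    (hrule : ∀ g g' : E d → ℝ, Continuous g → Continuous g' →
      MeasurableSet {p : E d × E d | rule g g' p.1 p.2})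
    (hU : ∀ t, Measurable (U t)) {y : E d} (hy : y ∈ X) (t : ℕ) {B : ℝ}
    (hB : ∀ u, ‖gradient rule X f x₀ η δ u t‖ ≤ B) :
    Integrable (fun ω => inner ℝ (gradient rule X f x₀ η δ (fun s => U s ω) t)
      (iterate rule X f x₀ η δ (fun s => U s ω) t - y)) P := by
  refine integrable_of_bound ((measurable_gradient hX hconv hx₀ hf hrule hU t).inner
    ((measurable_iterate hX hconv hx₀ hf hrule hU t).sub_const y)) (C := B * (2 * R)) fun ω => ?_
  have hm := iterate_mem (rule := rule) (f := f) (η := η) (δ := δ) hX hx₀ (fun s => U s ω) t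
  refine (abs_real_inner_le_norm _ _).trans ?_
  have h1 := hB (fun s => U s ω)
  exact mul_le_mul h1 (norm_sub_le_of_subset hR hm hy) (norm_nonneg _) ((norm_nonneg _).trans h1)

/-- Bias of the lazy estimator. On the symmetric core of the reuse region the residual is an odd
function of the direction, so that it averages out; the rest of the region costs its probability. -/
theorem le_integral_inner_gradient (hd : 1 ≤ d) (hX : IsClosed X) (hconv : Convex ℝ X)
    (hx₀ : x₀ ∈ X) (hR : X ⊆ Metric.closedBall 0 R) (hL : 0 ≤ L) (hδ : 0 < δ)
    (hfc : ∀ t, ConvexOn ℝ Set.univ (f t))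
    (hlip : ∀ t x y, |f t x - f t y| ≤ L * ‖x - y‖)
    (hrule : ∀ g g' : E d → ℝ, Continuous g → Continuous g' →
      MeasurableSet {p : E d × E d | rule g g' p.1 p.2})
    (hU : ∀ t, Measurable (U t)) (hind : iIndepFun U P)
    (hlaw : ∀ t, P.map (U t) = sphereUniform d) {y : E d} (hy : y ∈ X) (t : ℕ) {B : ℝ}
    (hB : ∀ u, ‖gradient rule X f x₀ η δ u t‖ ≤ B) :
    ∫ ω, f t (iterate rule X f x₀ η δ (fun s => U s ω) t) ∂P - f t y - 2 * L * δ
        - (B + d * L) * (2 * R) * P.real {ω | U t ω ∈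
          reuseRegion rule X f x₀ η δ (fun s => U s ω) t \
            symmetricCore (reuseRegion rule X f x₀ η δ (fun s => U s ω) t)}
      ≤ ∫ ω, inner ℝ (gradient rule X f x₀ η δ (fun s => U s ω) t)
          (iterate rule X f x₀ η δ (fun s => U s ω) t - y) ∂P := by
  have hσ := isProbabilityMeasure_sphereUniform hd
  have hf : ∀ t, Continuous (f t) := fun t => continuous_of_lipschitz (hlip t)
  set Z : Ω → E d × E d := fun ω => state rule X f x₀ η δ (fun s => U s ω) t with hZdef
  have hZ : Measurable Z :=
    (measurable_state hX hconv hx₀ hf hrule t).comp (measurable_pi_lambda _ hU)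
  have hindep : IndepFun Z (U t) P := indepFun_state hX hconv hx₀ hf hrule hU hind t
  have hZU : Measurable fun ω => (Z ω, U t ω) := hZ.prodMk (hU t)
  have hZmem : ∀ ω, (Z ω).1 ∈ X := fun ω => by
    rw [hZdef, fst_state]
    exact iterate_mem hX hx₀ _ _
  set A : Set ((E d × E d) × S d) := {p | p.2 ∈ stateRegion rule f δ t p.1} with hA
  set A' : Set ((E d × E d) × S d) := {p | p.2 ∈ symmetricCore (stateRegion rule f δ t p.1)} with hA'
  have hAm : MeasurableSet A := measurableSet_stateRegion hf hrule t
  have hAm' : MeasurableSet A' := measurableSet_symmetricCore_stateRegion hf hrule t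
  have hsub : A' ⊆ A := fun p hp => (mem_symmetricCore.1 hp).1
  set φ : (E d × E d) × S d → ℝ := fun p => inner ℝ (twoPoint δ (f t) p.1.1 p.2) (p.1.1 - y) with hφ
  set ψ : (E d × E d) × S d → ℝ := fun p => inner ℝ (residual f δ t p.1 p.2) (p.1.1 - y) with hψ
  have hφm : Measurable φ :=
    (measurable_twoPoint hf t).inner ((measurable_fst.fst).sub_const y)
  have hψm : Measurable ψ :=
    (measurable_residual hf t).inner ((measurable_fst.fst).sub_const y)
  have hdist : ∀ ω, ‖(Z ω).1 - y‖ ≤ 2 * R := fun ω => norm_sub_le_of_subset hR (hZmem ω) hy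
  have hR0 : 0 ≤ 2 * R := (norm_nonneg _).trans (norm_sub_le_of_subset hR hy hy)
  have hφb : ∀ ω, |φ (Z ω, U t ω)| ≤ d * L * (2 * R) := fun ω => by
    refine (abs_real_inner_le_norm _ _).trans ?_
    exact mul_le_mul (norm_twoPoint_le hδ (hlip t) _ _) (hdist ω) (norm_nonneg _) (by positivity)
  have hB0 : 0 ≤ B := by
    obtain ⟨ω⟩ := nonempty_of_isProbabilityMeasure P
    exact (norm_nonneg _).trans (hB (fun s => U s ω))
  have hψb : ∀ ω, (Z ω, U t ω) ∈ A → |ψ (Z ω, U t ω)| ≤ (B + d * L) * (2 * R) := fun ω hω => by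
    refine (abs_real_inner_le_norm _ _).trans ?_
    have h1 : residual f δ t (Z ω) (U t ω) = gradient rule X f x₀ η δ (fun s => U s ω) t
        - twoPoint δ (f t) (Z ω).1 (U t ω) := by
      rw [gradient, stateEstimator_of_mem hω]
      simp only [hZdef]
      abel
    have h2 : ‖residual f δ t (Z ω) (U t ω)‖ ≤ B + d * L := by
      rw [h1]
      exact (norm_sub_le _ _).trans (add_le_add (hB _) (norm_twoPoint_le hδ (hlip t) _ _))
    exact mul_le_mul h2 (hdist ω) (norm_nonneg _) (by positivity)
  have hc0 : 0 ≤ (B + d * L) * (2 * R) := by positivity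
  have hsplit : ∀ ω, inner ℝ (gradient rule X f x₀ η δ (fun s => U s ω) t)
      (iterate rule X f x₀ η δ (fun s => U s ω) t - y)
      = φ (Z ω, U t ω) + A'.indicator ψ (Z ω, U t ω) + (A \ A').indicator ψ (Z ω, U t ω) := by
    intro ω
    rw [← fst_state]
    by_cases h : (Z ω, U t ω) ∈ A
    · have e : A'.indicator ψ (Z ω, U t ω) + (A \ A').indicator ψ (Z ω, U t ω)
          = ψ (Z ω, U t ω) := by
        by_cases h' : (Z ω, U t ω) ∈ A'
        · simp [h']
        · simp [h', h]
      rw [add_assoc, e, gradient, stateEstimator_of_mem h, inner_add_left]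
    · have h' : (Z ω, U t ω) ∉ A' := fun hm => h (hsub hm)
      rw [gradient, stateEstimator_of_notMem h]
      simp [h, h', hφ, Z]
  have i1 : Integrable (fun ω => φ (Z ω, U t ω)) P := integrable_of_bound (hφm.comp hZU) hφb
  have i2 : Integrable (fun ω => A'.indicator ψ (Z ω, U t ω)) P := by
    refine integrable_of_bound ((hψm.indicator hAm').comp hZU) (C := (B + d * L) * (2 * R))
      fun ω => ?_
    by_cases h : (Z ω, U t ω) ∈ A'
    · simpa [h] using hψb ω (hsub h)
    · simpa [h] using hc0
  have i3 : Integrable (fun ω => (A \ A').indicator ψ (Z ω, U t ω)) P := by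
    refine integrable_of_bound ((hψm.indicator (hAm.diff hAm')).comp hZU)
      (C := (B + d * L) * (2 * R)) fun ω => ?_
    by_cases h : (Z ω, U t ω) ∈ A \ A'
    · rw [Set.indicator_of_mem h]
      exact hψb ω h.1
    · rw [Set.indicator_of_notMem h, abs_zero]
      exact hc0
  have h1 : ∫ ω, f t (iterate rule X f x₀ η δ (fun s => U s ω) t) ∂P - f t y - 2 * L * δ
      ≤ ∫ ω, φ (Z ω, U t ω) ∂P := by
    obtain ⟨j1, e1⟩ := integral_of_indepFun hZ (hU t) hindep hφm i1
    have hloss := integrable_loss (P := P) (η := η) (δ := δ) hX hconv hx₀ hR hL hlip hrule hU t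
    rw [e1]
    have hloss' : Integrable
        (fun ω => f t (iterate rule X f x₀ η δ (fun s => U s ω) t) - f t y) P :=
      hloss.sub (integrable_const _)
    have e2 : ∫ ω, f t (iterate rule X f x₀ η δ (fun s => U s ω) t) ∂P - f t y - 2 * L * δ
        = ∫ ω, (f t (iterate rule X f x₀ η δ (fun s => U s ω) t) - f t y - 2 * L * δ) ∂P := by
      rw [integral_sub hloss' (integrable_const _),
        integral_sub hloss (integrable_const _)]
      simp
    rw [e2]
    refine integral_mono (hloss'.sub (integrable_const _)) j1 fun ω => ?_
    simp only [hlaw, hφ, hZdef, fst_state]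
    exact le_integral_inner_twoPoint hd hL hδ (hfc t) (hlip t) _ y
  have h2 : ∫ ω, A'.indicator ψ (Z ω, U t ω) ∂P = 0 := by
    rw [(integral_of_indepFun hZ (hU t) hindep (hψm.indicator hAm') i2).2]
    have hzero : ∀ z, ∫ v, A'.indicator ψ (z, v) ∂(P.map (U t)) = 0 := by
      intro z
      rw [hlaw]
      have hm : Measurable fun v => A'.indicator ψ (z, v) :=
        (hψm.indicator hAm').comp measurable_prodMk_left
      have hodd : ∀ v, A'.indicator ψ (z, -v) = -A'.indicator ψ (z, v) := by
        intro v
        have hiff : (z, -v) ∈ A' ↔ (z, v) ∈ A' := by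
          simp only [hA', Set.mem_ofPred_eq, mem_symmetricCore, neg_neg]
          exact and_comm
        by_cases h : (z, v) ∈ A'
        · rw [Set.indicator_of_mem h, Set.indicator_of_mem (hiff.2 h)]
          simp only [hψ, residual_neg, inner_neg_left]
        · rw [Set.indicator_of_notMem h, Set.indicator_of_notMem (mt hiff.1 h), neg_zero]
      have := integral_comp_of_measurePreserving (measurePreserving_neg_sphereUniform d)
        hm.aestronglyMeasurable
      simp only [hodd, integral_neg] at this
      linarith
    simp [hzero]
  have h3 : -((B + d * L) * (2 * R) * P.real {ω | U t ω ∈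
          reuseRegion rule X f x₀ η δ (fun s => U s ω) t \
            symmetricCore (reuseRegion rule X f x₀ η δ (fun s => U s ω) t)})
      ≤ ∫ ω, (A \ A').indicator ψ (Z ω, U t ω) ∂P := by
    have hset : {ω | U t ω ∈ reuseRegion rule X f x₀ η δ (fun s => U s ω) t \
            symmetricCore (reuseRegion rule X f x₀ η δ (fun s => U s ω) t)}
        = (fun ω => (Z ω, U t ω)) ⁻¹' (A \ A') := by
      ext ω
      simp only [reuseRegion_eq]
      rfl
    have hmeas : MeasurableSet ((fun ω => (Z ω, U t ω)) ⁻¹' (A \ A')) := hZU (hAm.diff hAm')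
    rw [hset, ← smul_eq_mul ((B + d * L) * (2 * R)), smul_eq_mul, mul_comm, ← mul_neg,
      ← smul_eq_mul, ← integral_indicator_const _ hmeas]
    refine integral_mono ((integrable_const _).indicator hmeas) i3 fun ω => ?_
    by_cases h : (Z ω, U t ω) ∈ A \ A'
    · rw [Set.indicator_of_mem h, Set.indicator_of_mem (by exact h)]
      exact (abs_le.1 (hψb ω h.1)).1
    · rw [Set.indicator_of_notMem h, Set.indicator_of_notMem (by exact h)]
  simp_rw [hsplit]
  have i12 : Integrable (fun ω => φ (Z ω, U t ω) + A'.indicator ψ (Z ω, U t ω)) P := i1.add i2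
  rw [integral_add i12 i3, integral_add i1 i2, h2]
  linarith

/-- Second moment of the two-point estimator along the iterates. -/
theorem integral_norm_twoPoint_iterate_sq_le (hd : 1 ≤ d) (hX : IsClosed X) (hconv : Convex ℝ X)
    (hx₀ : x₀ ∈ X) (hL : 0 ≤ L) (hδ : 0 < δ)
    (hfc : ∀ t, ConvexOn ℝ Set.univ (f t))
    (hlip : ∀ t x y, |f t x - f t y| ≤ L * ‖x - y‖)
    (hrule : ∀ g g' : E d → ℝ, Continuous g → Continuous g' →
      MeasurableSet {p : E d × E d | rule g g' p.1 p.2})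
    (hU : ∀ t, Measurable (U t)) (hind : iIndepFun U P)
    (hlaw : ∀ t, P.map (U t) = sphereUniform d) (t : ℕ) :
    Integrable (fun ω => ‖twoPoint δ (f t) (iterate rule X f x₀ η δ (fun s => U s ω) t) (U t ω)‖ ^ 2)
        P ∧
      ∫ ω, ‖twoPoint δ (f t) (iterate rule X f x₀ η δ (fun s => U s ω) t) (U t ω)‖ ^ 2 ∂P
        ≤ 45 * d * L ^ 2 := by
  have hf : ∀ t, Continuous (f t) := fun t => continuous_of_lipschitz (hlip t)
  set Z : Ω → E d × E d := fun ω => state rule X f x₀ η δ (fun s => U s ω) t with hZdef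
  have hZ : Measurable Z :=
    (measurable_state hX hconv hx₀ hf hrule t).comp (measurable_pi_lambda _ hU)
  have hindep : IndepFun Z (U t) P := indepFun_state hX hconv hx₀ hf hrule hU hind t
  set φ : (E d × E d) × S d → ℝ := fun p => ‖twoPoint δ (f t) p.1.1 p.2‖ ^ 2 with hφ
  have hφm : Measurable φ := (measurable_twoPoint hf t).norm.pow_const 2
  have hint : Integrable (fun ω => φ (Z ω, U t ω)) P := by
    refine integrable_of_bound (hφm.comp (hZ.prodMk (hU t))) (C := (d * L) ^ 2) fun ω => ?_
    rw [abs_of_nonneg (sq_nonneg _)]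
    have := norm_twoPoint_le hδ (hlip t) (Z ω).1 (U t ω)
    simp only [hφ]
    gcongr
  obtain ⟨j1, e1⟩ := integral_of_indepFun hZ (hU t) hindep hφm hint
  simp only [hφ, hZdef, fst_state] at hint e1 j1
  refine ⟨hint, ?_⟩
  rw [e1]
  calc _ ≤ ∫ _, 45 * d * L ^ 2 ∂P := by
        refine integral_mono j1 (integrable_const _) fun ω => ?_
        simp only [hlaw]
        exact integral_norm_twoPoint_sq_le hd hL hδ (hfc t) (hlip t) _
    _ = _ := by simp

/-- Regret bound from an almost sure bound and a second moment bound for the estimator. -/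
theorem integrable_and_expectedRegret_le (hd : 1 ≤ d) (hX : IsClosed X) (hconv : Convex ℝ X)
    (hx₀ : x₀ ∈ X) (hR : X ⊆ Metric.closedBall 0 R) (hL : 0 ≤ L) (hη : 0 < η) (hδ : 0 < δ)
    (hfc : ∀ t, ConvexOn ℝ Set.univ (f t))
    (hlip : ∀ t x y, |f t x - f t y| ≤ L * ‖x - y‖)
    (hrule : ∀ g g' : E d → ℝ, Continuous g → Continuous g' →
      MeasurableSet {p : E d × E d | rule g g' p.1 p.2})
    (hU : ∀ t, Measurable (U t)) (hind : iIndepFun U P)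
    (hlaw : ∀ t, P.map (U t) = sphereUniform d) (T : ℕ) {B Q : ℝ}
    (hB : ∀ u t, ‖gradient rule X f x₀ η δ u t‖ ≤ B)
    (hQ : ∀ t, ∫ ω, ‖gradient rule X f x₀ η δ (fun s => U s ω) t‖ ^ 2 ∂P ≤ Q) :
    Integrable (cumulativeLoss rule X f x₀ η δ U T) P ∧
      expectedRegret P rule X f x₀ η δ U T ≤ (2 * R) ^ 2 / (2 * η) + η / 2 * ((T + 1) * Q)
        + (T + 1) * (2 * L * δ) + (B + d * L) * (2 * R) * asymmetry P rule X f x₀ η δ U T := by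
  have hf : ∀ t, Continuous (f t) := fun t => continuous_of_lipschitz (hlip t)
  have hloss := integrable_loss (P := P) (η := η) (δ := δ) hX hconv hx₀ hR hL hlip hrule hU
  have hcum : Integrable (cumulativeLoss rule X f x₀ η δ U T) P := by
    unfold cumulativeLoss
    exact integrable_finsetSum _ fun t _ => hloss t
  refine ⟨hcum, ?_⟩
  have hsq : ∀ t, Integrable (fun ω => ‖gradient rule X f x₀ η δ (fun s => U s ω) t‖ ^ 2) P := by
    intro t
    refine integrable_of_bound ((measurable_gradient hX hconv hx₀ hf hrule hU t).norm.pow_const 2)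
      (C := B ^ 2) fun ω => ?_
    rw [abs_of_nonneg (sq_nonneg _)]
    have := hB (fun s => U s ω) t
    gcongr
  have hinner : ∀ y ∈ X, ∀ t, Integrable (fun ω =>
      inner ℝ (gradient rule X f x₀ η δ (fun s => U s ω) t)
        (iterate rule X f x₀ η δ (fun s => U s ω) t - y)) P := fun y hy t =>
    integrable_inner_gradient hX hconv hx₀ hR hf hrule hU hy t fun u => hB u t
  set W : ℝ := (2 * R) ^ 2 / (2 * η) + η / 2 * ((T + 1) * Q)
        + (T + 1) * (2 * L * δ) + (B + d * L) * (2 * R) * asymmetry P rule X f x₀ η δ U T with hW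
  have key : ∀ y ∈ X, ∫ ω, cumulativeLoss rule X f x₀ η δ U T ω ∂P - W
      ≤ ∑ t ∈ Finset.range (T + 1), f t y := by
    intro y hy
    have h1 : ∫ ω, ∑ t ∈ Finset.range (T + 1),
          inner ℝ (gradient rule X f x₀ η δ (fun s => U s ω) t)
            (iterate rule X f x₀ η δ (fun s => U s ω) t - y) ∂P
        ≤ ∫ ω, ((2 * R) ^ 2 / (2 * η) + η / 2 * ∑ t ∈ Finset.range (T + 1),
          ‖gradient rule X f x₀ η δ (fun s => U s ω) t‖ ^ 2) ∂P := by
      refine integral_mono (integrable_finsetSum _ fun t _ => hinner y hy t)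
        ((integrable_const _).add ((integrable_finsetSum _ fun t _ => hsq t).const_mul _))
        fun ω => (sum_inner_gradient_le hX hconv hη hy (fun s => U s ω) (T + 1)).trans ?_
      have := norm_sub_le_of_subset hR hx₀ hy
      gcongr
    rw [integral_finsetSum _ fun t _ => hinner y hy t,
      integral_add (integrable_const _) ((integrable_finsetSum _ fun t _ => hsq t).const_mul _),
      integral_const_mul, integral_finsetSum _ fun t _ => hsq t] at h1
    have h2 : ∑ t ∈ Finset.range (T + 1),
        ∫ ω, ‖gradient rule X f x₀ η δ (fun s => U s ω) t‖ ^ 2 ∂P ≤ (T + 1) * Q := by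
      refine (Finset.sum_le_sum fun t _ => hQ t).trans ?_
      simp
    have h3 := Finset.sum_le_sum fun t (_ : t ∈ Finset.range (T + 1)) =>
      le_integral_inner_gradient hd hX hconv hx₀ hR hL hδ hfc hlip hrule hU hind hlaw hy t
        fun u => hB u t
    simp only [Finset.sum_sub_distrib, ← Finset.mul_sum, Finset.sum_const, Finset.card_range,
      nsmul_eq_mul, Nat.cast_add, Nat.cast_one] at h3
    have h4 : ∫ ω, cumulativeLoss rule X f x₀ η δ U T ω ∂P = ∑ t ∈ Finset.range (T + 1),
        ∫ ω, f t (iterate rule X f x₀ η δ (fun s => U s ω) t) ∂P := by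
      unfold cumulativeLoss
      exact integral_finsetSum _ fun t _ => hloss t
    have h5 := mul_le_mul_of_nonneg_left h2 (half_pos hη).le
    simp only [integral_const, probReal_univ, one_smul] at h1
    rw [h4, hW]
    unfold asymmetry
    linarith
  have hinf : ∫ ω, cumulativeLoss rule X f x₀ η δ U T ω ∂P - W
      ≤ sInf ((fun y => ∑ t ∈ Finset.range (T + 1), f t y) '' X) := by
    refine le_csInf (Set.Nonempty.image _ ⟨x₀, hx₀⟩) ?_
    rintro _ ⟨y, hy, rfl⟩
    exact key y hy
  unfold expectedRegret
  rw [integral_sub hcum (integrable_const _)]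
  simp only [integral_const, probReal_univ, one_smul]
  linarith

end Probability

end Regret

/-! ### The two lazy rules -/

section Rules

variable {d : ℕ} {X : Set (E d)} {f : ℕ → E d → ℝ} {x₀ : E d} {η δ L D : ℝ}

theorem norm_onePoint (hδ : 0 < δ) (g g' : E d → ℝ) (x : E d) (v : S d) (w' : E d) :
    ‖onePoint δ g g' x v w'‖ = d / δ * |g (x + δ • (v : E d)) - g' w'| := by
  unfold onePoint
  rw [norm_smul, norm_mul, Real.norm_of_nonneg (by positivity)]
  simp

theorem ruleA_iff {g g' : E d → ℝ} {w w' : E d} (hD : 0 ≤ D) :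
    ruleA D g g' w w' ↔ |g w - g' w'| ≤ D * ‖w - w'‖ := by
  unfold ruleA temporalVariationA
  rw [ENNReal.div_le_iff_le_mul (.inr ENNReal.ofReal_ne_top) (.inl (edist_ne_top _ _)), edist_dist,
    edist_dist, ← ENNReal.ofReal_mul hD, ENNReal.ofReal_le_ofReal_iff (by positivity),
    Real.dist_eq, dist_eq_norm]

theorem ruleB_iff {g g' : E d → ℝ} {w w' : E d} (hη : 0 < η) (hL : 0 < L) :
    ruleB η L D g g' w w' ↔ |g w - g' w'| ≤ D * (η * L) := by
  unfold ruleB temporalVariationB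
  rw [div_le_iff₀ (by positivity)]

theorem measurableSet_ruleA (hD : 0 ≤ D) (g g' : E d → ℝ) (hg : Continuous g)
    (hg' : Continuous g') : MeasurableSet {p : E d × E d | ruleA D g g' p.1 p.2} := by
  simp only [ruleA_iff hD]
  exact (isClosed_le (by fun_prop) (by fun_prop)).measurableSet

theorem measurableSet_ruleB (hη : 0 < η) (hL : 0 < L) (g g' : E d → ℝ) (hg : Continuous g)
    (hg' : Continuous g') : MeasurableSet {p : E d × E d | ruleB η L D g g' p.1 p.2} := by
  simp only [ruleB_iff hη hL]
  exact (isClosed_le (by fun_prop) (by fun_prop)).measurableSet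

/-- Either the estimator of a round is the two-point one, or the lazy rule holds. -/
theorem gradient_eq_or {rule : Rule d} (u : ℕ → S d) (t : ℕ) :
    gradient rule X f x₀ η δ u t = twoPoint δ (f t) (iterate rule X f x₀ η δ u t) (u t) ∨
      ∃ s, t = s + 1 ∧
        rule (f t) (f s) (iterate rule X f x₀ η δ u t + δ • (u t : E d))
          (iterate rule X f x₀ η δ u s + δ • (u s : E d)) ∧
        gradient rule X f x₀ η δ u t = onePoint δ (f t) (f s) (iterate rule X f x₀ η δ u t) (u t)
          (iterate rule X f x₀ η δ u s + δ • (u s : E d)) := by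
  cases t with
  | zero => exact .inl rfl
  | succ s =>
    by_cases h : rule (f (s + 1)) (f s) (iterate rule X f x₀ η δ u (s + 1) + δ • (u (s + 1) : E d))
          (iterate rule X f x₀ η δ u s + δ • (u s : E d))
    · exact .inr ⟨s, rfl, h, if_pos h⟩
    · exact .inl (if_neg h)

/-- Under the second rule, the one-point estimator is bounded by the threshold. -/
theorem norm_gradient_ruleB (hη : 0 < η) (hL : 0 < L) (hδ : 0 < δ) (hηδ : d * (η * L) = δ)
    (u : ℕ → S d) (t : ℕ) :
    gradient (ruleB η L D) X f x₀ η δ u t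
        = twoPoint δ (f t) (iterate (ruleB η L D) X f x₀ η δ u t) (u t) ∨
      ‖gradient (ruleB η L D) X f x₀ η δ u t‖ ≤ D := by
  rcases gradient_eq_or (rule := ruleB η L D) (X := X) (f := f) (x₀ := x₀) (η := η) (δ := δ) u t
    with h | ⟨s, -, hr, hg⟩
  · exact .inl h
  · right
    rw [ruleB_iff hη hL] at hr
    rw [hg, norm_onePoint hδ]
    calc _ ≤ d / δ * (D * (η * L)) := by gcongr
      _ = D * (d * (η * L)) / δ := by ring
      _ = D := by rw [hηδ, mul_div_cancel_right₀ _ hδ.ne']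

/-- Under the first rule, the one-point estimator is controlled by the estimator of the previous
round, through the distance between consecutive query points. -/
theorem norm_gradient_ruleA (hX : IsClosed X) (hconv : Convex ℝ X) (hx₀ : x₀ ∈ X) (hη : 0 < η)
    (hL : 0 < L) (hδ : 0 < δ) (hηδ : d * (η * L) = δ) (hD : 0 ≤ D) (u : ℕ → S d) (t : ℕ) :
    gradient (ruleA D) X f x₀ η δ u t
        = twoPoint δ (f t) (iterate (ruleA D) X f x₀ η δ u t) (u t) ∨
      ∃ s, t = s + 1 ∧ ‖gradient (ruleA D) X f x₀ η δ u t‖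
        ≤ 2 * d * D + D / L * ‖gradient (ruleA D) X f x₀ η δ u s‖ := by
  rcases gradient_eq_or (rule := ruleA D) (X := X) (f := f) (x₀ := x₀) (η := η) (δ := δ) u t
    with h | ⟨s, hs, hr, hg⟩
  · exact .inl h
  · refine .inr ⟨s, hs, ?_⟩
    rw [ruleA_iff hD] at hr
    rw [hg, norm_onePoint hδ]
    subst hs
    set x := iterate (ruleA D) X f x₀ η δ u s with hx
    set g := gradient (ruleA D) X f x₀ η δ u s with hgs
    have hstep : ‖iterate (ruleA D) X f x₀ η δ u (s + 1) - x‖ ≤ η * ‖g‖ := by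
      have h1 := norm_proj_sub_le hX hconv (x - η • g) (iterate_mem (rule := ruleA D) (f := f)
        (η := η) (δ := δ) hX hx₀ u s)
      rw [sub_sub_cancel_left, norm_neg, norm_smul, Real.norm_of_nonneg hη.le] at h1
      rw [iterate_succ]
      exact h1
    have hdist : ‖iterate (ruleA D) X f x₀ η δ u (s + 1) + δ • (u (s + 1) : E d)
        - (x + δ • (u s : E d))‖ ≤ 2 * δ + η * ‖g‖ := by
      have e : iterate (ruleA D) X f x₀ η δ u (s + 1) + δ • (u (s + 1) : E d)
        - (x + δ • (u s : E d)) = (iterate (ruleA D) X f x₀ η δ u (s + 1) - x)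
          + (δ • (u (s + 1) : E d) - δ • (u s : E d)) := by abel
      rw [e]
      have h2 : ‖δ • (u (s + 1) : E d) - δ • (u s : E d)‖ ≤ 2 * δ := by
        refine (norm_sub_le _ _).trans ?_
        rw [norm_smul, norm_smul, Real.norm_of_nonneg hδ.le]
        simp only [norm_eq_of_mem_sphere]
        linarith
      linarith [norm_add_le (iterate (ruleA D) X f x₀ η δ u (s + 1) - x)
        (δ • (u (s + 1) : E d) - δ • (u s : E d))]
    calc _ ≤ d / δ * (D * (2 * δ + η * ‖g‖)) := by
          gcongr
          exact hr.trans (by gcongr)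
      _ = 2 * d * D * (δ / δ) + D / L * ‖g‖ * ((d * (η * L)) / δ) := by field_simp
      _ = 2 * d * D + D / L * ‖g‖ := by rw [hηδ, div_self hδ.ne']; ring

end Rules

/-! ### Regret of the two rules for losses that are convex and Lipschitz everywhere -/

theorem sqrt_div_eq_sqrt_mul_div {b : ℝ} (hb : 0 < b) (a : ℝ) : √(a / b) = √(a * b) / b := by
  rw [← Real.sqrt_sq hb.le, ← Real.sqrt_div' _ (sq_nonneg b), Real.sqrt_sq hb.le]
  congr 1
  field_simp

/-- Insertion of the step size and of the perturbation radius into the regret bound. -/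
theorem regret_constant {d T : ℕ} {R L η δ q b K p : ℝ} (hd : 1 ≤ d) (hT : 1 ≤ T) (hR : 0 < R)
    (hL : 0 < L) (hη : η = R / (L * √((d : ℝ) * T))) (hδ : δ = R * √((d : ℝ) / T)) (hq : 0 ≤ q)
    (hb : 0 ≤ b) (hp : p ≤ K * √((T : ℝ) / d)) :
    (2 * R) ^ 2 / (2 * η) + η / 2 * ((T + 1) * (q * (d * L ^ 2))) + (T + 1) * (2 * L * δ)
        + (b * (d * L) + d * L) * (2 * R) * p
      ≤ (6 + q + 2 * (b + 1) * K) * R * L * √((d : ℝ) * T) := by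
  have hd' : (1 : ℝ) ≤ d := by exact_mod_cast hd
  have hT' : (1 : ℝ) ≤ T := by exact_mod_cast hT
  set s := √((d : ℝ) * T) with hs
  have hs2 : s ^ 2 = d * T := Real.sq_sqrt (by positivity)
  have hspos : 0 < s := Real.sqrt_pos.2 (by positivity)
  have h1 : √((d : ℝ) / T) = s / T := sqrt_div_eq_sqrt_mul_div (by positivity) _
  have h2 : √((T : ℝ) / d) = s / d := by
    rw [hs, mul_comm]
    exact sqrt_div_eq_sqrt_mul_div (by positivity) _
  rw [h1] at hδ
  rw [h2] at hp
  have e1 : (2 * R) ^ 2 / (2 * η) = 2 * R * L * s := by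
    rw [hη]
    field_simp
  have e2 : η / 2 * ((T + 1) * (q * (d * L ^ 2))) ≤ q * R * L * s := by
    have : η / 2 * ((T + 1) * (q * (d * L ^ 2))) = (q * R * L * (d / s)) * ((T + 1) / 2) := by
      rw [hη]
      field_simp
    rw [this]
    calc _ ≤ (q * R * L * (d / s)) * T := by
          gcongr
          linarith
      _ = q * R * L * (d * T / s) := by ring
      _ = q * R * L * s := by
          rw [← hs2]
          field_simp
  have e3 : (T + 1) * (2 * L * δ) ≤ 4 * R * L * s := by
    have : (T + 1) * (2 * L * δ) = (2 * R * L * s) * ((T + 1) / T) := by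
      rw [hδ]
      field_simp
    rw [this]
    have h3 : ((T : ℝ) + 1) / T ≤ 2 := by
      rw [div_le_iff₀ (by linarith)]
      linarith
    calc _ ≤ (2 * R * L * s) * 2 := by gcongr
      _ = _ := by ring
  have e4 : (b * (d * L) + d * L) * (2 * R) * p ≤ 2 * (b + 1) * K * R * L * s := by
    calc _ ≤ (b * (d * L) + d * L) * (2 * R) * (K * (s / d)) := by gcongr
      _ = _ := by
        field_simp
  linarith

section GlobalLosses

variable {d T : ℕ} {R L η δ K M D : ℝ} {X : Set (E d)} {f : ℕ → E d → ℝ} {x₀ : E d}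
  {Ω : Type*} [MeasurableSpace Ω] {P : Measure Ω} [IsProbabilityMeasure P] {U : ℕ → Ω → S d}

theorem step_mul_eq_radius (hd : 1 ≤ d) (hT : 1 ≤ T) (hL : 0 < L)
    (hη : η = R / (L * √((d : ℝ) * T))) (hδ : δ = R * √((d : ℝ) / T)) : d * (η * L) = δ := by
  have hd' : (1 : ℝ) ≤ d := by exact_mod_cast hd
  have hT' : (1 : ℝ) ≤ T := by exact_mod_cast hT
  have hspos : 0 < √((d : ℝ) * T) := Real.sqrt_pos.2 (by positivity)
  have hs2 : √((d : ℝ) * T) ^ 2 = d * T := Real.sq_sqrt (by positivity)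
  rw [hη, hδ, sqrt_div_eq_sqrt_mul_div (by positivity)]
  field_simp
  rw [hs2]
  ring

/-- A round contributes either the two-point estimator or a vector of norm at most `D`. -/
theorem regret_ruleB (hd : 1 ≤ d) (hT : 1 ≤ T) (hR : 0 < R) (hL : 0 < L)
    (hη : η = R / (L * √((d : ℝ) * T))) (hδ : δ = R * √((d : ℝ) / T))
    (hX : IsClosed X) (hconv : Convex ℝ X) (hXR : X ⊆ Metric.closedBall 0 R) (hx₀ : x₀ ∈ X)
    (hfc : ∀ t, ConvexOn ℝ Set.univ (f t))
    (hlip : ∀ t x y, |f t x - f t y| ≤ L * ‖x - y‖)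
    (hU : ∀ t, Measurable (U t)) (hind : iIndepFun U P)
    (hlaw : ∀ t, P.map (U t) = sphereUniform d)
    (hD : 0 < D) (hDM : D ≤ M * (√(d : ℝ) * L))
    (hasym : asymmetry P (ruleB η L D) X f x₀ η δ U T ≤ K * √((T : ℝ) / d)) :
    Integrable (cumulativeLoss (ruleB η L D) X f x₀ η δ U T) P ∧
      expectedRegret P (ruleB η L D) X f x₀ η δ U T
        ≤ (51 + M ^ 2 + 2 * (M + 2) * K) * R * L * √((d : ℝ) * T) := by
  have hd' : (1 : ℝ) ≤ d := by exact_mod_cast hd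
  have hT' : (1 : ℝ) ≤ T := by exact_mod_cast hT
  have hη0 : 0 < η := by rw [hη]; positivity
  have hδ0 : 0 < δ := by rw [hδ]; positivity
  have hηδ := step_mul_eq_radius hd hT hL hη hδ
  have hsd2 : √(d : ℝ) ^ 2 = d := Real.sq_sqrt (by positivity)
  have hsd1 : 1 ≤ √(d : ℝ) := Real.one_le_sqrt.2 hd'
  have hM : 0 ≤ M := by
    by_contra! hneg
    have : M * (√(d : ℝ) * L) ≤ 0 := mul_nonpos_of_nonpos_of_nonneg hneg.le (by positivity)
    linarith
  have hD1 : D ≤ M * (d * L) := by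
    have : √(d : ℝ) ≤ d := by nlinarith
    exact hDM.trans (by gcongr)
  have hD2 : D ^ 2 ≤ M ^ 2 * (d * L ^ 2) := by
    calc D ^ 2 ≤ (M * (√(d : ℝ) * L)) ^ 2 := by gcongr
      _ = M ^ 2 * (√(d : ℝ) ^ 2 * L ^ 2) := by ring
      _ = _ := by rw [hsd2]
  have hrule := measurableSet_ruleB (d := d) (D := D) hη0 hL
  have hf : ∀ t, Continuous (f t) := fun t => continuous_of_lipschitz (hlip t)
  have hB : ∀ u t, ‖gradient (ruleB η L D) X f x₀ η δ u t‖ ≤ (M + 1) * (d * L) := by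
    intro u t
    have h0 : 0 ≤ M * (d * L) := by positivity
    have h1 : 0 ≤ d * L := by positivity
    rcases norm_gradient_ruleB (X := X) (f := f) (x₀ := x₀) (D := D) hη0 hL hδ0 hηδ u t with h | h
    · rw [h]
      linarith [norm_twoPoint_le hδ0 (hlip t) (iterate (ruleB η L D) X f x₀ η δ u t) (u t)]
    · linarith
  have hQ : ∀ t, ∫ ω, ‖gradient (ruleB η L D) X f x₀ η δ (fun s => U s ω) t‖ ^ 2 ∂P
      ≤ (45 + M ^ 2) * (d * L ^ 2) := by
    intro t
    obtain ⟨i1, h1⟩ := integral_norm_twoPoint_iterate_sq_le (P := P) (η := η) hd hX hconv hx₀ hL.le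
      hδ0 hfc hlip hrule hU hind hlaw t
    calc _ ≤ ∫ ω, (‖twoPoint δ (f t)
            (iterate (ruleB η L D) X f x₀ η δ (fun s => U s ω) t) (U t ω)‖ ^ 2 + D ^ 2) ∂P := by
          refine integral_mono_of_nonneg (.of_forall fun ω => sq_nonneg _)
            (i1.add (integrable_const _)) (.of_forall fun ω => ?_)
          rcases norm_gradient_ruleB (X := X) (f := f) (x₀ := x₀) (D := D) hη0 hL hδ0 hηδ
            (fun s => U s ω) t with h | h
          · simp only [h]
            linarith [sq_nonneg D]
          · have : ‖gradient (ruleB η L D) X f x₀ η δ (fun s => U s ω) t‖ ^ 2 ≤ D ^ 2 := by gcongr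
            simp only
            linarith [sq_nonneg ‖twoPoint δ (f t)
              (iterate (ruleB η L D) X f x₀ η δ (fun s => U s ω) t) (U t ω)‖]
      _ ≤ _ := by
          rw [integral_add i1 (integrable_const _)]
          simp only [integral_const, probReal_univ, one_smul]
          linarith
  obtain ⟨hint, hreg⟩ := integrable_and_expectedRegret_le hd hX hconv hx₀ hXR hL.le hη0 hδ0 hfc
    hlip hrule hU hind hlaw T hB hQ
  refine ⟨hint, hreg.trans ((regret_constant hd hT hR hL hη hδ (by positivity)
    (by positivity) hasym).trans (le_of_eq ?_))⟩
  ring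

/-- As `D < L / √10`, the estimator of the previous round enters the bound for the next one with a
factor below `1 / √10`, so that both the norms and their second moments stay bounded. -/
theorem regret_ruleA (hd : 1 ≤ d) (hT : 1 ≤ T) (hR : 0 < R) (hL : 0 < L)
    (hη : η = R / (L * √((d : ℝ) * T))) (hδ : δ = R * √((d : ℝ) / T))
    (hX : IsClosed X) (hconv : Convex ℝ X) (hXR : X ⊆ Metric.closedBall 0 R) (hx₀ : x₀ ∈ X)
    (hfc : ∀ t, ConvexOn ℝ Set.univ (f t))
    (hlip : ∀ t x y, |f t x - f t y| ≤ L * ‖x - y‖)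
    (hU : ∀ t, Measurable (U t)) (hind : iIndepFun U P)
    (hlaw : ∀ t, P.map (U t) = sphereUniform d)
    (hD : 0 < D) (hDM : D ≤ M * (L / √(d : ℝ))) (hDL : D < L / √10)
    (hasym : asymmetry P (ruleA D) X f x₀ η δ U T ≤ K * √((T : ℝ) / d)) :
    Integrable (cumulativeLoss (ruleA D) X f x₀ η δ U T) P ∧
      expectedRegret P (ruleA D) X f x₀ η δ U T
        ≤ (66 + 10 * M ^ 2 + 6 * K) * R * L * √((d : ℝ) * T) := by
  have hd' : (1 : ℝ) ≤ d := by exact_mod_cast hd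
  have hT' : (1 : ℝ) ≤ T := by exact_mod_cast hT
  have hη0 : 0 < η := by rw [hη]; positivity
  have hδ0 : 0 < δ := by rw [hδ]; positivity
  have hηδ := step_mul_eq_radius hd hT hL hη hδ
  have hsd2 : √(d : ℝ) ^ 2 = d := Real.sq_sqrt (by positivity)
  have h10 : √(10 : ℝ) ^ 2 = 10 := Real.sq_sqrt (by norm_num)
  have hratio : (D / L) ^ 2 ≤ 1 / 10 := by
    have h1 : D / L ≤ 1 / √10 := by
      rw [div_le_div_iff₀ hL (by positivity)]
      rw [lt_div_iff₀ (by positivity)] at hDL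
      linarith
    calc (D / L) ^ 2 ≤ (1 / √10) ^ 2 := by gcongr
      _ = 1 / 10 := by rw [div_pow, h10, one_pow]
  have hratio0 : 0 ≤ D / L := by positivity
  have hratio1 : D / L ≤ 1 / 2 := by nlinarith
  have hDL2 : D ≤ L / 2 := by
    rw [div_le_iff₀ hL] at hratio1
    linarith
  have hD2 : d * D ^ 2 ≤ M ^ 2 * L ^ 2 := by
    calc d * D ^ 2 ≤ d * (M * (L / √(d : ℝ))) ^ 2 := by gcongr
      _ = d * (M ^ 2 * L ^ 2 / √(d : ℝ) ^ 2) := by ring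
      _ = M ^ 2 * L ^ 2 := by
          rw [hsd2]
          field_simp
  have hrule := measurableSet_ruleA (d := d) hD.le
  have hf : ∀ t, Continuous (f t) := fun t => continuous_of_lipschitz (hlip t)
  have hB : ∀ u t, ‖gradient (ruleA D) X f x₀ η δ u t‖ ≤ 2 * (d * L) := by
    intro u t
    have h1 : 0 ≤ d * L := by positivity
    induction t with
    | zero =>
      rcases norm_gradient_ruleA (f := f) hX hconv hx₀ hη0 hL hδ0 hηδ hD.le u 0
        with h | ⟨s, hs, h⟩
      · rw [h]
        linarith [norm_twoPoint_le hδ0 (hlip 0) (iterate (ruleA D) X f x₀ η δ u 0) (u 0)]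
      · omega
    | succ t ih =>
      rcases norm_gradient_ruleA (f := f) hX hconv hx₀ hη0 hL hδ0 hηδ hD.le u (t + 1)
        with h | ⟨s, hs, h⟩
      · rw [h]
        linarith [norm_twoPoint_le hδ0 (hlip (t + 1)) (iterate (ruleA D) X f x₀ η δ u (t + 1))
          (u (t + 1))]
      · obtain rfl : t = s := by omega
        have h2 : 2 * d * D ≤ 2 * d * (L / 2) := by gcongr
        have h3 : D / L * ‖gradient (ruleA D) X f x₀ η δ u t‖ ≤ 1 / 2 * (2 * (d * L)) := by
          gcongr
        linarith
  have hsq : ∀ t, Integrable (fun ω => ‖gradient (ruleA D) X f x₀ η δ (fun s => U s ω) t‖ ^ 2)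
      P := by
    intro t
    refine integrable_of_bound ((measurable_gradient hX hconv hx₀ hf hrule hU t).norm.pow_const 2)
      (C := (2 * (d * L)) ^ 2) fun ω => ?_
    rw [abs_of_nonneg (sq_nonneg _)]
    have := hB (fun s => U s ω) t
    gcongr
  have hdL2 : 0 ≤ d * L ^ 2 := by positivity
  have hMdL : 0 ≤ M ^ 2 * (d * L ^ 2) := by positivity
  have hdD : 8 * (d * D) ^ 2 ≤ 8 * M ^ 2 * (d * L ^ 2) := by
    calc 8 * (d * D) ^ 2 = 8 * d * (d * D ^ 2) := by ring
      _ ≤ 8 * d * (M ^ 2 * L ^ 2) := by gcongr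
      _ = _ := by ring
  -- The squared norms satisfy `a (t + 1) ≤ two-point part + 8 (d D)² + a t / 5`.
  have hrec : ∀ t ω, ‖gradient (ruleA D) X f x₀ η δ (fun s => U s ω) (t + 1)‖ ^ 2
      ≤ ‖twoPoint δ (f (t + 1)) (iterate (ruleA D) X f x₀ η δ (fun s => U s ω) (t + 1))
          (U (t + 1) ω)‖ ^ 2 + (8 * M ^ 2 * (d * L ^ 2)
        + 1 / 5 * ‖gradient (ruleA D) X f x₀ η δ (fun s => U s ω) t‖ ^ 2) := by
    intro t ω
    rcases norm_gradient_ruleA (f := f) hX hconv hx₀ hη0 hL hδ0 hηδ hD.le (fun s => U s ω) (t + 1)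
      with h | ⟨s, hs, h⟩
    · rw [h]
      linarith [sq_nonneg ‖gradient (ruleA D) X f x₀ η δ (fun s => U s ω) t‖]
    · obtain rfl : t = s := by omega
      set a := ‖gradient (ruleA D) X f x₀ η δ (fun s => U s ω) t‖
      have h1 : (2 * d * D + D / L * a) ^ 2 ≤ 8 * (d * D) ^ 2 + 1 / 5 * a ^ 2 := by
        have h2 : (D / L) ^ 2 * a ^ 2 ≤ 1 / 10 * a ^ 2 := by gcongr
        nlinarith [sq_nonneg (2 * d * D - D / L * a)]
      have h3 : ‖gradient (ruleA D) X f x₀ η δ (fun s => U s ω) (t + 1)‖ ^ 2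
          ≤ (2 * d * D + D / L * a) ^ 2 := by gcongr
      linarith [sq_nonneg ‖twoPoint δ (f (t + 1))
        (iterate (ruleA D) X f x₀ η δ (fun s => U s ω) (t + 1)) (U (t + 1) ω)‖]
  have hQ : ∀ t, ∫ ω, ‖gradient (ruleA D) X f x₀ η δ (fun s => U s ω) t‖ ^ 2 ∂P
      ≤ (60 + 10 * M ^ 2) * (d * L ^ 2) := by
    intro t
    induction t with
    | zero =>
      obtain ⟨-, h1⟩ := integral_norm_twoPoint_iterate_sq_le (P := P) (η := η) hd hX hconv hx₀
        hL.le hδ0 hfc hlip hrule hU hind hlaw 0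
      have e : ∀ ω, gradient (ruleA D) X f x₀ η δ (fun s => U s ω) 0
          = twoPoint δ (f 0) (iterate (ruleA D) X f x₀ η δ (fun s => U s ω) 0) (U 0 ω) :=
        fun ω => rfl
      simp only [e]
      linarith
    | succ t ih =>
      obtain ⟨i1, h1⟩ := integral_norm_twoPoint_iterate_sq_le (P := P) (η := η) hd hX hconv hx₀
        hL.le hδ0 hfc hlip hrule hU hind hlaw (t + 1)
      have i2 : Integrable (fun ω => 8 * M ^ 2 * (d * L ^ 2)
          + 1 / 5 * ‖gradient (ruleA D) X f x₀ η δ (fun s => U s ω) t‖ ^ 2) P :=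
        (integrable_const _).add ((hsq t).const_mul _)
      refine (integral_mono (hsq (t + 1)) (i1.add i2) (hrec t)).trans ?_
      simp only [Pi.add_apply]
      rw [integral_add i1 i2, integral_add (integrable_const _) ((hsq t).const_mul _),
        integral_const_mul (1 / 5 : ℝ)]
      simp only [integral_const, probReal_univ, one_smul]
      linarith
  obtain ⟨hint, hreg⟩ := integrable_and_expectedRegret_le hd hX hconv hx₀ hXR hL.le hη0 hδ0 hfc
    hlip hrule hU hind hlaw T hB hQ
  refine ⟨hint, hreg.trans ((regret_constant hd hT hR hL hη hδ (by positivity)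
    (by norm_num) hasym).trans (le_of_eq ?_))⟩
  ring

end GlobalLosses

/-! ### Reduction to losses that are convex and Lipschitz everywhere -/

section Reduction

variable {d T : ℕ} {η δ : ℝ} {X : Set (E d)} {f h : ℕ → E d → ℝ} {x₀ : E d} {rule : Rule d}

/-- A rule is local if it depends on the two losses only through their values at the two query
points. -/
def IsLocalRule (rule : Rule d) : Prop :=
  ∀ (g g' k k' : E d → ℝ) (w w' : E d), g w = k w → g' w' = k' w' →
    (rule g g' w w' ↔ rule k k' w w')

theorem isLocalRule_ruleA (D : ℝ) : IsLocalRule (ruleA (d := d) D) := by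
  intro g g' k k' w w' h1 h2
  simp only [ruleA, temporalVariationA, h1, h2]

theorem isLocalRule_ruleB (η L D : ℝ) : IsLocalRule (ruleB (d := d) η L D) := by
  intro g g' k k' w w' h1 h2
  simp only [ruleB, temporalVariationB, h1, h2]

theorem add_smul_mem_cthickening (hδ : 0 ≤ δ) {x : E d} (hx : x ∈ X) (v : S d) :
    x + δ • (v : E d) ∈ Metric.cthickening δ X := by
  refine Metric.mem_cthickening_of_dist_le _ x _ _ hx ?_
  rw [dist_eq_norm, add_sub_cancel_left, norm_smul, Real.norm_of_nonneg hδ]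
  simp

theorem twoPoint_congr (hδ : 0 ≤ δ) {g k : E d → ℝ}
    (hgk : ∀ p ∈ Metric.cthickening δ X, g p = k p) {x : E d} (hx : x ∈ X) (v : S d) :
    twoPoint δ g x v = twoPoint δ k x v := by
  have h2 := add_smul_mem_cthickening hδ hx (-v)
  simp only [coe_neg_sphere, smul_neg, ← sub_eq_add_neg] at h2
  simp only [twoPoint, hgk _ (add_smul_mem_cthickening hδ hx v), hgk _ h2]

theorem state_mem (hX : IsClosed X) (hx₀ : x₀ ∈ X) (hδ : 0 ≤ δ) (u : ℕ → S d) (t : ℕ) :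
    (state rule X f x₀ η δ u t).1 ∈ X ∧
      (0 < t → (state rule X f x₀ η δ u t).2 ∈ Metric.cthickening δ X) := by
  refine ⟨by rw [fst_state]; exact iterate_mem hX hx₀ u t, fun ht => ?_⟩
  obtain ⟨s, rfl⟩ := Nat.exists_eq_succ_of_ne_zero ht.ne'
  exact add_smul_mem_cthickening hδ (iterate_mem hX hx₀ u s) (u s)

theorem stateRegion_congr (hloc : IsLocalRule rule) (hδ : 0 ≤ δ)
    (hfh : ∀ t ≤ T, ∀ p ∈ Metric.cthickening δ X, f t p = h t p) {t : ℕ} (ht : t ≤ T)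
    {z : E d × E d} (hz : z.1 ∈ X) (hz' : 0 < t → z.2 ∈ Metric.cthickening δ X) :
    stateRegion rule f δ t z = stateRegion rule h δ t z := by
  cases t with
  | zero => rfl
  | succ t =>
    ext v
    exact hloc _ _ _ _ _ _ (hfh _ ht _ (add_smul_mem_cthickening hδ hz v))
      (hfh _ (by omega) _ (hz' (by omega)))

theorem stateEstimator_congr (hloc : IsLocalRule rule) (hδ : 0 ≤ δ)
    (hfh : ∀ t ≤ T, ∀ p ∈ Metric.cthickening δ X, f t p = h t p) {t : ℕ} (ht : t ≤ T)
    {z : E d × E d} (hz : z.1 ∈ X) (hz' : 0 < t → z.2 ∈ Metric.cthickening δ X) (v : S d) :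
    stateEstimator rule f δ t z v = stateEstimator rule h δ t z v := by
  have hreg := stateRegion_congr hloc hδ hfh ht hz hz'
  have htwo := twoPoint_congr hδ (hfh t ht) hz v
  have hres : residual f δ t z v = residual h δ t z v := by
    cases t with
    | zero => rfl
    | succ t =>
      simp only [residual, onePoint, htwo, hfh _ ht _ (add_smul_mem_cthickening hδ hz v),
        hfh t (by omega) _ (hz' (by omega))]
  by_cases hv : v ∈ stateRegion rule f δ t z
  · rw [stateEstimator_of_mem hv, stateEstimator_of_mem (hreg ▸ hv), htwo, hres]
  · rw [stateEstimator_of_notMem hv, stateEstimator_of_notMem (hreg ▸ hv), htwo]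

theorem state_congr_loss (hloc : IsLocalRule rule) (hX : IsClosed X) (hx₀ : x₀ ∈ X) (hδ : 0 ≤ δ)
    (hfh : ∀ t ≤ T, ∀ p ∈ Metric.cthickening δ X, f t p = h t p) (u : ℕ → S d) {t : ℕ}
    (ht : t ≤ T) : state rule X f x₀ η δ u t = state rule X h x₀ η δ u t := by
  induction t with
  | zero => rfl
  | succ t ih =>
    have ih' := ih (by omega)
    have hi : iterate rule X f x₀ η δ u t = iterate rule X h x₀ η δ u t := by
      rw [← fst_state, ih', fst_state]
    have hz := state_mem (rule := rule) (f := h) (η := η) hX hx₀ hδ u t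
    rw [state_succ, state_succ, hi, ih',
      stateEstimator_congr hloc hδ hfh (by omega) hz.1 hz.2]

theorem iterate_congr_loss (hloc : IsLocalRule rule) (hX : IsClosed X) (hx₀ : x₀ ∈ X) (hδ : 0 ≤ δ)
    (hfh : ∀ t ≤ T, ∀ p ∈ Metric.cthickening δ X, f t p = h t p) (u : ℕ → S d) {t : ℕ}
    (ht : t ≤ T) : iterate rule X f x₀ η δ u t = iterate rule X h x₀ η δ u t := by
  rw [← fst_state, state_congr_loss hloc hX hx₀ hδ hfh u ht, fst_state]

variable {Ω : Type*} {U : ℕ → Ω → S d}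

theorem asymmetry_congr_loss [MeasurableSpace Ω] (P : Measure Ω) (hloc : IsLocalRule rule)
    (hX : IsClosed X) (hx₀ : x₀ ∈ X) (hδ : 0 ≤ δ)
    (hfh : ∀ t ≤ T, ∀ p ∈ Metric.cthickening δ X, f t p = h t p) :
    asymmetry P rule X f x₀ η δ U T = asymmetry P rule X h x₀ η δ U T := by
  unfold asymmetry
  refine Finset.sum_congr rfl fun t ht => ?_
  have ht' : t ≤ T := Nat.lt_succ_iff.1 (Finset.mem_range.1 ht)
  have e : ∀ ω, reuseRegion rule X f x₀ η δ (fun s => U s ω) t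
      = reuseRegion rule X h x₀ η δ (fun s => U s ω) t := by
    intro ω
    have hz := state_mem (rule := rule) (f := h) (η := η) hX hx₀ hδ (fun s => U s ω) t
    rw [reuseRegion_eq, reuseRegion_eq, state_congr_loss hloc hX hx₀ hδ hfh _ ht',
      stateRegion_congr hloc hδ hfh ht' hz.1 hz.2]
  simp only [e]

theorem cumulativeLoss_congr_loss (hloc : IsLocalRule rule) (hX : IsClosed X) (hx₀ : x₀ ∈ X)
    (hδ : 0 ≤ δ) (hfh : ∀ t ≤ T, ∀ p ∈ Metric.cthickening δ X, f t p = h t p) :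
    cumulativeLoss rule X f x₀ η δ U T = cumulativeLoss rule X h x₀ η δ U T := by
  funext ω
  refine Finset.sum_congr rfl fun t ht => ?_
  have ht' : t ≤ T := Nat.lt_succ_iff.1 (Finset.mem_range.1 ht)
  rw [iterate_congr_loss hloc hX hx₀ hδ hfh _ ht']
  exact hfh t ht' _ (Metric.self_subset_cthickening X (iterate_mem hX hx₀ _ t))

theorem expectedRegret_congr_loss [MeasurableSpace Ω] (P : Measure Ω) (hloc : IsLocalRule rule)
    (hX : IsClosed X) (hx₀ : x₀ ∈ X) (hδ : 0 ≤ δ)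
    (hfh : ∀ t ≤ T, ∀ p ∈ Metric.cthickening δ X, f t p = h t p) :
    expectedRegret P rule X f x₀ η δ U T = expectedRegret P rule X h x₀ η δ U T := by
  have e : (fun y => ∑ t ∈ Finset.range (T + 1), f t y) '' X
      = (fun y => ∑ t ∈ Finset.range (T + 1), h t y) '' X :=
    Set.image_congr fun y hy => Finset.sum_congr rfl fun t ht =>
      hfh t (Nat.lt_succ_iff.1 (Finset.mem_range.1 ht)) _ (Metric.self_subset_cthickening X hy)
  simp only [expectedRegret, e, cumulativeLoss_congr_loss hloc hX hx₀ hδ hfh]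

end Reduction

end LAZO

theorem theorem1 (K M : ℝ) :
    ∃ C : ℝ, ∀ (d T : ℕ) (R L η δ : ℝ) (X : Set (LAZO.E d)) (f : ℕ → LAZO.E d → ℝ)
      (x₀ : LAZO.E d) (Ω : Type*) (_ : MeasurableSpace Ω) (P : Measure Ω)
      (u : ℕ → Ω → LAZO.S d),
      1 ≤ d → 1 ≤ T → 0 < R → 0 < L →
      η = R / (L * √((d : ℝ) * T)) → δ = R * √((d : ℝ) / T) →
      IsClosed X → Convex ℝ X → X ⊆ Metric.closedBall 0 R → x₀ ∈ X →
      (∀ t ≤ T, ∀ x ∈ Metric.cthickening δ X, ∀ y ∈ Metric.cthickening δ X,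
        |f t x - f t y| ≤ L * ‖x - y‖) →
      (∀ t ≤ T, ConvexOn ℝ (Metric.cthickening δ X) (f t)) →
      IsProbabilityMeasure P → (∀ t, Measurable (u t)) → iIndepFun u P →
      (∀ t, P.map (u t) = LAZO.sphereUniform d) →
      (∀ D : ℝ, 0 < D → D ≤ M * (L / √(d : ℝ)) → D < L / √10 →
        LAZO.asymmetry P (LAZO.ruleA D) X f x₀ η δ u T ≤ K * √((T : ℝ) / d) →
        Integrable (LAZO.cumulativeLoss (LAZO.ruleA D) X f x₀ η δ u T) P ∧
        LAZO.expectedRegret P (LAZO.ruleA D) X f x₀ η δ u T ≤ C * R * L * √((d : ℝ) * T)) ∧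
      (∀ D : ℝ, 0 < D → D ≤ M * (√(d : ℝ) * L) →
        LAZO.asymmetry P (LAZO.ruleB η L D) X f x₀ η δ u T ≤ K * √((T : ℝ) / d) →
        Integrable (LAZO.cumulativeLoss (LAZO.ruleB η L D) X f x₀ η δ u T) P ∧
        LAZO.expectedRegret P (LAZO.ruleB η L D) X f x₀ η δ u T ≤ C * R * L * √((d : ℝ) * T)) := by
  refine ⟨max (66 + 10 * M ^ 2 + 6 * K) (51 + M ^ 2 + 2 * (M + 2) * K), ?_⟩
  intro d T R L η δ X f x₀ Ω _ P u hd hT hR hL hη hδ hX hconv hXR hx₀ hlip hfc hP hu hind hlaw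
  have hδ0 : 0 ≤ δ := by rw [hδ]; positivity
  have hne : (Metric.cthickening δ X).Nonempty := ⟨x₀, Metric.self_subset_cthickening X hx₀⟩
  -- Only the losses up to round `T` are constrained; the later ones are replaced by zero.
  let h : ℕ → LAZO.E d → ℝ := fun t =>
    if t ≤ T then LAZO.lipschitzExtension (Metric.cthickening δ X) L (f t) else 0
  have hfh : ∀ t ≤ T, ∀ p ∈ Metric.cthickening δ X, f t p = h t p := by
    intro t ht p hp
    simp only [h, if_pos ht]
    exact (LAZO.lipschitzExtension_eq (hlip t ht) hL.le hp).symm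
  have hh : ∀ t, ConvexOn ℝ Set.univ (h t) := by
    intro t
    by_cases ht : t ≤ T
    · simp only [h, if_pos ht]
      exact LAZO.convexOn_lipschitzExtension (hlip t ht) hL.le hne (hfc t ht)
    · simp only [h, if_neg ht]
      exact convexOn_const 0 convex_univ
  have hhlip : ∀ t x y, |h t x - h t y| ≤ L * ‖x - y‖ := by
    intro t x y
    by_cases ht : t ≤ T
    · simp only [h, if_pos ht]
      exact LAZO.lipschitzExtension_sub_le (hlip t ht) hL.le hne x y
    · simp only [h, if_neg ht, Pi.zero_apply, sub_self, abs_zero]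
      positivity
  have hle : ∀ C C' : ℝ, C ≤ C' → C * R * L * √((d : ℝ) * T) ≤ C' * R * L * √((d : ℝ) * T) := by
    intro C C' hC
    gcongr
  constructor
  · intro D hD hDM hDL hasym
    have hloc := LAZO.isLocalRule_ruleA (d := d) D
    rw [LAZO.asymmetry_congr_loss P hloc hX hx₀ hδ0 hfh] at hasym
    rw [LAZO.cumulativeLoss_congr_loss hloc hX hx₀ hδ0 hfh,
      LAZO.expectedRegret_congr_loss P hloc hX hx₀ hδ0 hfh]
    obtain ⟨hint, hreg⟩ := LAZO.regret_ruleA hd hT hR hL hη hδ hX hconv hXR hx₀ hh hhlip hu hind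
      hlaw hD hDM hDL hasym
    exact ⟨hint, hreg.trans (hle _ _ (le_max_left _ _))⟩
  · intro D hD hDM hasym
    have hloc := LAZO.isLocalRule_ruleB (d := d) η L D
    rw [LAZO.asymmetry_congr_loss P hloc hX hx₀ hδ0 hfh] at hasym
    rw [LAZO.cumulativeLoss_congr_loss hloc hX hx₀ hδ0 hfh,
      LAZO.expectedRegret_congr_loss P hloc hX hx₀ hδ0 hfh]
    obtain ⟨hint, hreg⟩ := LAZO.regret_ruleB hd hT hR hL hη hδ hX hconv hXR hx₀ hh hhlip hu hind
      hlaw hD hDM hasym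
    exact ⟨hint, hreg.trans (hle _ _ (le_max_right _ _))⟩
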